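/- Let $A$ be a totally ordered integral domain. **Specker algebras.** A commutative $A$-algebra $S$ with $1$ is a *Specker $A$-algebra* if it is generated as an $A$-algebra by a Boolean subalgebra of its Boolean algebra of idempotents $\mathrm{Id}(S)$ (with $e\wedge k=ek$, $e\vee k=e+k-ek$, $\neg e=1-e$) whose nonzero elements $e$ are faithful, i.e. $ae=0$ implies $a=0$ for $a\in A$. Such an $S$ is regarded with its lattice order making it a torsion-free $f$-algebra over $A$: an $\ell$-ring that is a subdirect product of totally ordered rings, with $as\ge 0$ whenever $0\le a\in A$, $0\le s\in S$, and with no $A$-torsion. Put $|s|=s\vee(-s)$. **Proximities.** A *proximity Specker $A$-algebra* is a pair $(S,\prec)$ where $S$ is a Specker $A$-algebra and $\prec$ is a binary relation on $S$ such that 1. $0\prec 0$ and $1\prec 1$; 2. $s\prec t$ implies $s\le t$; 3. $s\le t\prec r\le u$ implies $s\prec u$; 4. $s\prec t$ and $s\prec r$ imply $s\prec t\wedge r$; 5. $s\prec t$ implies $-t\prec -s$; 6. $s\prec t$ and $r\prec u$ imply $s+r\prec t+u$; 7. $s\prec t$ implies $as\prec at$ for all $0<a\in A$, and $as\prec at$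 for some $0<a\in A$ implies $s\prec t$; 8. if $s,t,r,u\ge 0$, $s\prec t$ and $r\prec u$, then $sr\prec tu$; 9. $s\prec t$ implies $s\prec r\prec t$ for some $r\in S$; 10. $s>0$ implies that there is $0<t\in S$ with $t\prec s$. **Ends of $(S,\prec)$.** An $\ell$-ideal of $S$ is an ideal $I$ such that $|s|\le|t|$ and $t\in I$ imply $s\in I$. It is *round* if $I=S$, or if $I=\{s\in S: |s|\prec t\text{ for some }t\in I\}$ and $I\cap A=0$ (where $a\in A$ is read as $a\cdot 1\in S$). An *end* of $(S,\prec)$ is a maximal element of the set of proper round ideals. $\mathsf{End}(S,\prec)$ is the set of ends, topologized by the basis of sets $U(s)=\{I: s\in I\}$, $s\in S$. **Proximity morphisms to $A$.** On $A$, as an algebra over itself, the only relation satisfying 1--10 is $\le$. A *proximity morphism* $\alpha:S\to A$ is a map such that for all $s,t\in S$ and $a\in A$: $\alpha(0)=0$; $\alpha(s\wedge t)=\alpha(s)\wedge\alpha(t)$; $s\prec t$ implies $-\alpha(-s)\le\alpha(t)$; $\alpha(s)$ is the least upper bound of $\{\alpha(t):t\prec s\}$; $\alpha(s+a)=\alpha(s)+a$;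 $\alpha(as)=a\alpha(s)$ if $a>0$; $\alpha(s\vee a)=\alpha(s)\vee a$. $\mathsf{Hom}(S,A)$ is the set of proximity morphisms $S\to A$, topologized by the basis of sets $V(s)=\{\alpha: |s|\prec t\text{ and }\alpha(t)=0\text{ for some }t\in S\}$, $s\in S$. **Ends of a Boolean algebra with proximity.** A relation $\prec$ on a Boolean algebra $B$ is a *proximity* if: $1\prec 1$; $a\prec b$ implies $a\le b$; $a\le b\prec c\le d$ implies $a\prec d$; $a\prec b$ and $a\prec c$ imply $a\prec b\wedge c$; $a\prec b$ implies $\neg b\prec\neg a$; $a\prec b$ implies $a\prec c\prec b$ for some $c\in B$; and each $a\ne 0$ has some $0\neq b\prec a$. An ideal $I$ of $B$ is *round* if $I=\{a\in B: a\prec e\text{ for some }e\in I\}$; an *end* of $(B,\prec)$ is a maximal element of the set of proper round ideals. The space of ends of $(B,\prec)$ is the set of ends topologized by the basis of sets $\zeta(a)=\{I: a\in I\}$, $a\in B$. **Theorem.** Let $(S,\prec)$ be a proximity Specker $A$-algebra and let $B=\mathrm{Id}(S)$ with the restriction of $\prec$. Then the restriction of $\prec$ is a proximity on the Boolean algebra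 $B$, the space $X$ of ends of $(B,\prec)$ is compact Hausdorff, and the spaces $\mathsf{End}(S,\prec)$ and $\mathsf{Hom}(S,A)$ are both homeomorphic to $X$. -/

import Mathlib

universe u v w

/-! ### Boolean algebras with a proximity and their spaces of ends -/

/-- `prec` is a proximity on the Boolean algebra `B` (de Vries axioms, without completeness). -/
structure IsBooleanProximity {B : Type u} [BooleanAlgebra B] (prec : B → B → Prop) : Prop where
  top_prec_top : prec ⊤ ⊤
  le_of_prec : ∀ a b, prec a b → a ≤ b
  mono : ∀ a b c d, a ≤ b → prec b c → c ≤ d → prec a d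
  prec_inf : ∀ a b c, prec a b → prec a c → prec a (b ⊓ c)
  compl : ∀ a b, prec a b → prec bᶜ aᶜ
  interpolate : ∀ a b, prec a b → ∃ c, prec a c ∧ prec c b
  exists_prec : ∀ a, a ≠ ⊥ → ∃ b, b ≠ ⊥ ∧ prec b a

/-- An ideal `I` of a Boolean algebra is round if
`I = {a | a ≺ e for some e ∈ I}`. -/
def IsRoundBoolIdeal {B : Type u} [BooleanAlgebra B] (prec : B → B → Prop)
    (I : Order.Ideal B) : Prop :=
  {a : B | ∃ e ∈ I, prec a e} = (I : Set B)

/-- The ends of `(B, ≺)`: the ideals that are maximal among the proper round ideals. -/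
def BoolEnd {B : Type u} [BooleanAlgebra B] (prec : B → B → Prop) : Type u :=
  {I : Order.Ideal B // Maximal (fun J : Order.Ideal B => J ≠ ⊤ ∧ IsRoundBoolIdeal prec J) I}

/-- The topology on the ends of `(B, ≺)` with basis the sets `ζ(a) = {I | a ∈ I}`. -/
instance BoolEnd.instTopologicalSpace {B : Type u} [BooleanAlgebra B] (prec : B → B → Prop) :
    TopologicalSpace (BoolEnd prec) :=
  TopologicalSpace.generateFrom (Set.range fun a : B => {I : BoolEnd prec | a ∈ I.1})

/-! ### The Boolean algebra of idempotents -/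

/-- The idempotents of a commutative ring. -/
def Idem (S : Type u) [CommRing S] : Type u := {e : S // IsIdempotentElem e}

/-- The Boolean algebra structure on the idempotents: `e ⊓ k = e * k`, `e ⊔ k = e + k - e * k`,
`eᶜ = 1 - e`. -/
instance Idem.instBooleanAlgebra (S : Type u) [CommRing S] : BooleanAlgebra (Idem S) :=
  inferInstanceAs (BooleanAlgebra {e : S // IsIdempotentElem e})

/-- The restriction to the idempotents of a relation on the ring. -/
def idemRel {S : Type u} [CommRing S] (prec : S → S → Prop) : Idem S → Idem S → Prop :=
  fun e k => prec e.1 k.1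

/-! ### Lattice-ordered rings and algebras -/

/-- A ring with a lattice order is an `ℓ`-ring. -/
structure IsLRing (S : Type u) [Ring S] [Lattice S] : Prop where
  add_le_add_right : ∀ a b c : S, a ≤ b → a + c ≤ b + c
  mul_nonneg : ∀ a b : S, 0 ≤ a → 0 ≤ b → 0 ≤ a * b

/-- An `f`-ring: an `ℓ`-ring that is a subdirect product of totally ordered rings. The factors
may be taken in the universe of `S`, as they are quotients of `S`. -/
structure IsFRing (S : Type u) [Ring S] [Lattice S] : Prop extends IsLRing S where
  subdirect : ∃ (ι : Type u) (R : ι → Type u) (_ : ∀ i, Ring (R i)) (_ : ∀ i, LinearOrder (R i))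
    (π : ∀ i, S →+* R i),
    (∀ i, IsLRing (R i)) ∧
    (∀ i, Function.Surjective (π i)) ∧
    (∀ i s t, π i (s ⊓ t) = π i s ⊓ π i t) ∧
    (∀ i s t, π i (s ⊔ t) = π i s ⊔ π i t) ∧
    (∀ s t, (∀ i, π i s = π i t) → s = t)

/-- `S` is a torsion-free `f`-algebra over `A`. -/
structure IsTorsionFreeFAlgebra (A : Type u) [CommRing A] [LinearOrder A]
    (S : Type v) [CommRing S] [Algebra A S] [Lattice S] : Prop extends IsFRing S where
  smul_nonneg : ∀ (a : A) (s : S), 0 ≤ a → 0 ≤ s → 0 ≤ a • s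
  torsion_free : ∀ (a : A) (s : S), a • s = 0 → a = 0 ∨ s = 0

/-- `S` is a Specker `A`-algebra: it is generated as an `A`-algebra by a Boolean subalgebra of
its idempotents all of whose nonzero elements are faithful. -/
def IsSpecker (A : Type u) [CommRing A] (S : Type v) [CommRing S] [Algebra A S] : Prop :=
  ∃ B : BooleanSubalgebra (Idem S),
    (∀ e ∈ B, e.1 ≠ 0 → ∀ a : A, a • e.1 = 0 → a = 0) ∧
    Algebra.adjoin A {s : S | ∃ e ∈ B, e.1 = s} = ⊤

/-! ### Proximities on algebras -/

/-- The proximity axioms for a relation on an `f`-algebra `S` over `A`. -/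
structure IsProximity (A : Type u) [CommRing A] [LinearOrder A]
    {S : Type v} [CommRing S] [Algebra A S] [Lattice S] (prec : S → S → Prop) : Prop where
  zero_prec_zero : prec 0 0
  one_prec_one : prec 1 1
  le_of_prec : ∀ s t, prec s t → s ≤ t
  mono : ∀ s t r u, s ≤ t → prec t r → r ≤ u → prec s u
  prec_inf : ∀ s t r, prec s t → prec s r → prec s (t ⊓ r)
  neg : ∀ s t, prec s t → prec (-t) (-s)
  add : ∀ s t r u, prec s t → prec r u → prec (s + r) (t + u)
  smul : ∀ (a : A) (s t : S), 0 < a → prec s t → prec (a • s) (a • t)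
  of_smul : ∀ (a : A) (s t : S), 0 < a → prec (a • s) (a • t) → prec s t
  mul : ∀ s t r u, 0 ≤ s → 0 ≤ t → 0 ≤ r → 0 ≤ u → prec s t → prec r u → prec (s * r) (t * u)
  interpolate : ∀ s t, prec s t → ∃ r, prec s r ∧ prec r t
  exists_prec : ∀ s, 0 < s → ∃ t, 0 < t ∧ prec t s

/-- `(S, ≺)` is a proximity Specker `A`-algebra. -/
structure IsProximitySpecker (A : Type u) [CommRing A] [LinearOrder A]
    {S : Type v} [CommRing S] [Algebra A S] [Lattice S] (prec : S → S → Prop) : Prop where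
  fAlgebra : IsTorsionFreeFAlgebra A S
  proximity : IsProximity A prec
  specker : IsSpecker A S

/-! ### Ends of a proximity algebra -/

/-- `I` is an `ℓ`-ideal. -/
def IsLIdeal {S : Type v} [CommRing S] [Lattice S] (I : Ideal S) : Prop :=
  ∀ s t : S, |s| ≤ |t| → t ∈ I → s ∈ I

/-- A round ideal of `(S, ≺)`: an `ℓ`-ideal `I` such that either `I = S`, or
`I = {s | |s| ≺ t for some t ∈ I}` and `I ∩ A = 0`. -/
def IsRoundIdeal (A : Type u) [CommRing A]
    {S : Type v} [CommRing S] [Algebra A S] [Lattice S] (prec : S → S → Prop)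
    (I : Ideal S) : Prop :=
  IsLIdeal I ∧
    (I = ⊤ ∨
      ({s : S | ∃ t ∈ I, prec |s| t} = (I : Set S) ∧
        ∀ a : A, algebraMap A S a ∈ I → algebraMap A S a = 0))

/-- The ends of `(S, ≺)`: the ideals that are maximal among the proper round ideals. -/
def AlgEnd (A : Type u) [CommRing A]
    {S : Type v} [CommRing S] [Algebra A S] [Lattice S] (prec : S → S → Prop) : Type v :=
  {I : Ideal S // Maximal (fun J : Ideal S => J ≠ ⊤ ∧ IsRoundIdeal A prec J) I}

/-- The topology on the ends of `(S, ≺)` with basis the sets `U(s) = {I | s ∈ I}`. -/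
instance AlgEnd.instTopologicalSpace (A : Type u) [CommRing A]
    {S : Type v} [CommRing S] [Algebra A S] [Lattice S] (prec : S → S → Prop) :
    TopologicalSpace (AlgEnd A prec) :=
  TopologicalSpace.generateFrom (Set.range fun s : S => {I : AlgEnd A prec | s ∈ I.1})

/-! ### Proximity morphisms -/

/-- `α : S → T` is a proximity morphism from `(S, precS)` to `(T, precT)`. -/
structure IsProximityMorphism (A : Type u) [CommRing A] [LinearOrder A]
    {S : Type v} [CommRing S] [Algebra A S] [Lattice S] (precS : S → S → Prop)
    {T : Type w} [CommRing T] [Algebra A T] [Lattice T] (precT : T → T → Prop)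
    (α : S → T) : Prop where
  map_zero : α 0 = 0
  map_inf : ∀ s t, α (s ⊓ t) = α s ⊓ α t
  map_prec : ∀ s t, precS s t → precT (-α (-s)) (α t)
  isLUB : ∀ s, IsLUB {x : T | ∃ t, precS t s ∧ α t = x} (α s)
  map_add_const : ∀ (s : S) (a : A), α (s + algebraMap A S a) = α s + algebraMap A T a
  map_smul : ∀ (a : A) (s : S), 0 < a → α (a • s) = a • α s
  map_sup_const : ∀ (s : S) (a : A), α (s ⊔ algebraMap A S a) = α s ⊔ algebraMap A T a

/-- The order `≤` is the only proximity on the totally ordered domain `A`, regarded as an algebra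
over itself. -/
theorem isProximity_self_iff (A : Type u) [CommRing A] [IsDomain A] [LinearOrder A]
    [IsOrderedRing A] (prec : A → A → Prop) :
    IsProximity A prec ↔ prec = fun a b => a ≤ b := by
  have : IsStrictOrderedRing A := IsOrderedRing.toIsStrictOrderedRing A
  constructor
  · intro h
    have key : ∀ a : A, prec a a := by
      intro a
      rcases lt_trichotomy a 0 with ha | ha | ha
      · have := h.neg _ _ (h.smul (-a) 1 1 (neg_pos.2 ha) h.one_prec_one)
        simpa using this
      · subst ha
        exact h.zero_prec_zero
      · simpa using h.smul a 1 1 ha h.one_prec_one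
    funext a b
    exact propext ⟨h.le_of_prec a b, fun hab => h.mono a a a b le_rfl (key a) hab⟩
  · rintro rfl
    exact
      { zero_prec_zero := le_rfl
        one_prec_one := le_rfl
        le_of_prec := fun _ _ h => h
        mono := fun _ _ _ _ h1 h2 h3 => h1.trans (h2.trans h3)
        prec_inf := fun _ _ _ h1 h2 => le_inf h1 h2
        neg := fun _ _ h => neg_le_neg h
        add := fun _ _ _ _ h1 h2 => add_le_add h1 h2
        smul := fun a _ _ ha h => mul_le_mul_of_nonneg_left h ha.le
        of_smul := fun a _ _ ha h => le_of_mul_le_mul_left h ha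
        mul := fun _ _ _ _ _ h2 h3 _ h5 h6 => mul_le_mul h5 h6 h3 h2
        interpolate := fun s _ h => ⟨s, le_rfl, h⟩
        exists_prec := fun s hs => ⟨s, hs, le_rfl⟩ }

/-- The proximity morphisms from `(S, ≺)` to `A`, where `A` carries its unique proximity `≤`. -/
def ProxHom (A : Type u) [CommRing A] [LinearOrder A]
    {S : Type v} [CommRing S] [Algebra A S] [Lattice S] (prec : S → S → Prop) : Type (max u v) :=
  {α : S → A // IsProximityMorphism A prec (fun a b : A => a ≤ b) α}

/-- The topology on the proximity morphisms `S → A` with basis the sets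
`V(s) = {α | |s| ≺ t and α(t) = 0 for some t}`. -/
instance ProxHom.instTopologicalSpace (A : Type u) [CommRing A] [LinearOrder A]
    {S : Type v} [CommRing S] [Algebra A S] [Lattice S] (prec : S → S → Prop) :
    TopologicalSpace (ProxHom A prec) :=
  TopologicalSpace.generateFrom
    (Set.range fun s : S => {α : ProxHom A prec | ∃ t, prec |s| t ∧ α.1 t = 0})

/-! ### The space of ends of a Boolean algebra with a proximity -/

/-! Everything is reduced to idempotents and read pointwise. An `f`-algebra is a subdirect product
of totally ordered rings, and an idempotent of such a ring is 0 or 1, so inequalities in `S` can be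
checked factor by factor (`IsTorsionFreeFAlgebra.le_of_points`). An element of a Specker algebra is
constant on each piece of a finite cover by idempotents (`IsSpecker.induction`). Hence each `s ≥ 0`
has a support `e` with `a • e ≤ s ≤ b • e` for positive scalars (`exists_support`). Scalars can be
cancelled from the proximity: `a • e ≤ s ≺ t ≤ b • k` forces `e ≺ k` (`prec_of_smul_le`). Replacing
interpolants and lower bounds by their supports then gives the Boolean proximity.

For a Boolean proximity, a proper round ideal is an end exactly when `a ≺ b` always implies that it
contains `a` or `bᶜ` (`maximal_iff`). This gives the Hausdorff property at once, and compactness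
through the Alexander subbasis theorem and Zorn's lemma.

For ends of `S`, an element is sent to its support. The ideal of elements supported in `J` and the
ideal of idempotents with a positive multiple in `I` are monotone constructions preserving proper
round ideals, and on maximal ones they are mutually inverse.

For morphisms, an end `J` need not be prime, so `s` has no limit at `J` in general, only a lower
limit: a scalar `c` with `s ≥ c` off a member of `J` and `s ≤ c` on some idempotent outside `J`.
Lower limits exist, are unique and monotone, and define a proximity morphism. Conversely, a morphism
`α` is 0-1 valued on idempotents, the `e` with `α(eᶜ) = 1` form an end, and `α(s)` is a lower limit
of `s` there, so uniqueness recovers `α`. Both bijections match basic open sets through supports. -/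

/-- The order ideal with a given carrier that contains `⊥`, is closed under joins, and is a lower
set. -/
def orderIdealOf {B : Type u} [SemilatticeSup B] [OrderBot B] (P : B → Prop) (bot : P ⊥)
    (sup : ∀ a b, P a → P b → P (a ⊔ b)) (lower : ∀ a b, a ≤ b → P b → P a) : Order.Ideal B where
  carrier := {a | P a}
  lower' := fun a b hba ha => lower b a hba ha
  nonempty' := ⟨⊥, bot⟩
  directed' := fun a ha b hb => ⟨a ⊔ b, sup a b ha hb, le_sup_left, le_sup_right⟩

namespace IsBooleanProximity

variable {B : Type u} [BooleanAlgebra B] {prec : B → B → Prop}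

theorem compl_iff (h : IsBooleanProximity prec) {a b : B} : prec bᶜ aᶜ ↔ prec a b :=
  ⟨fun hab => by simpa using h.compl _ _ hab, h.compl _ _⟩

theorem bot_prec_bot (h : IsBooleanProximity prec) : prec ⊥ ⊥ := by
  simpa using h.compl _ _ h.top_prec_top

theorem sup_prec (h : IsBooleanProximity prec) {a b c : B} (ha : prec a c) (hb : prec b c) :
    prec (a ⊔ b) c := by
  rw [← h.compl_iff, compl_sup]
  exact h.prec_inf _ _ _ (h.compl _ _ ha) (h.compl _ _ hb)

theorem sup_prec_sup (h : IsBooleanProximity prec) {a b c d : B} (ha : prec a c)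
    (hb : prec b d) : prec (a ⊔ b) (c ⊔ d) :=
  h.sup_prec (h.mono _ _ _ _ le_rfl ha le_sup_left) (h.mono _ _ _ _ le_rfl hb le_sup_right)

theorem isRound_iff (h : IsBooleanProximity prec) {I : Order.Ideal B} :
    IsRoundBoolIdeal prec I ↔ ∀ a ∈ I, ∃ e ∈ I, prec a e := by
  constructor
  · intro hI a ha
    have : a ∈ {a : B | ∃ e ∈ I, prec a e} := by rw [hI]; exact ha
    exact this
  · intro hI
    ext a
    exact ⟨fun ⟨e, he, hae⟩ => I.lower (h.le_of_prec _ _ hae) he, fun ha => hI a ha⟩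

/-- The round ideal `{x | x ≺ b}`. -/
def below (h : IsBooleanProximity prec) (b : B) : Order.Ideal B :=
  orderIdealOf (fun x => prec x b) (h.mono _ _ _ _ le_rfl h.bot_prec_bot bot_le)
    (fun _ _ => h.sup_prec) (fun _ _ hab hb => h.mono _ _ _ _ hab hb le_rfl)

/-- A proper round ideal is an end exactly when it decides each pair `a ≺ b`. -/
theorem maximal_iff (h : IsBooleanProximity prec) {I : Order.Ideal B} :
    Maximal (fun J : Order.Ideal B => J ≠ ⊤ ∧ IsRoundBoolIdeal prec J) I ↔
      (I ≠ ⊤ ∧ IsRoundBoolIdeal prec I) ∧ ∀ a b, prec a b → a ∈ I ∨ bᶜ ∈ I := by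
  constructor
  · intro hI
    refine ⟨hI.prop, fun a b hab => ?_⟩
    -- Adjoining everything `≺ b` keeps the ideal round. If the result is improper, `bᶜ` lies below
    -- an element of `I`; otherwise maximality of `I` puts `a` in it.
    by_cases hJ : I ⊔ h.below b = ⊤
    · right
      have : (⊤ : B) ∈ I ⊔ h.below b := by rw [hJ]; trivial
      obtain ⟨i, hi, j, hj, hij⟩ := Order.Ideal.mem_sup.1 this
      refine I.lower ?_ hi
      have hjb : j ≤ b := h.le_of_prec _ _ hj
      have h1 : i ⊔ b = ⊤ := top_le_iff.1 (hij.trans (sup_le_sup_left hjb i))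
      exact codisjoint_iff_compl_le_left.1 (codisjoint_iff.2 h1)
    · left
      have hround : IsRoundBoolIdeal prec (I ⊔ h.below b) := by
        rw [h.isRound_iff]
        intro x hx
        obtain ⟨i, hi, j, hj, hij⟩ := Order.Ideal.mem_sup.1 hx
        obtain ⟨i', hi', hii'⟩ := h.isRound_iff.1 hI.prop.2 i hi
        obtain ⟨j', hjj', hj'⟩ := h.interpolate _ _ hj
        exact ⟨i' ⊔ j', Order.Ideal.mem_sup.2 ⟨i', hi', j', hj', le_rfl⟩,
          h.mono _ _ _ _ hij (h.sup_prec_sup hii' hjj') le_rfl⟩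
      have hle := hI.le_of_ge ⟨hJ, hround⟩ le_sup_left
      exact hle (Order.Ideal.mem_sup.2 ⟨⊥, I.bot_mem, a, hab, by simp⟩)
  · rintro ⟨hI, hdec⟩
    refine ⟨hI, fun J hJ hIJ x hx => ?_⟩
    obtain ⟨y, hy, hxy⟩ := h.isRound_iff.1 hJ.2 x hx
    rcases hdec x y hxy with hx' | hy'
    · exact hx'
    · exact absurd (Order.Ideal.top_mem_iff_eq_top.1
        (by simpa using Order.Ideal.sup_mem hy (hIJ hy'))) hJ.1

/-- Zorn's lemma: properness and roundness each concern one element at a time, so both pass to the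
union of a chain. -/
theorem exists_end_ge (h : IsBooleanProximity prec) {I : Order.Ideal B} (hI : I ≠ ⊤)
    (hr : IsRoundBoolIdeal prec I) : ∃ J : BoolEnd prec, I ≤ J.1 := by
  have chain_bound : ∀ c ⊆ {J : Order.Ideal B | J ≠ ⊤ ∧ IsRoundBoolIdeal prec J},
      IsChain (· ≤ ·) c → ∀ y ∈ c,
      ∃ ub ∈ {J : Order.Ideal B | J ≠ ⊤ ∧ IsRoundBoolIdeal prec J}, ∀ z ∈ c, z ≤ ub := by
    intro c hc hchain y hy
    let U : Order.Ideal B := orderIdealOf (fun x => ∃ J ∈ c, x ∈ J) ⟨y, hy, y.bot_mem⟩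
      (by
        rintro a b ⟨J, hJ, ha⟩ ⟨K, hK, hb⟩
        rcases hchain.total hJ hK with hJK | hJK
        · exact ⟨K, hK, Order.Ideal.sup_mem (hJK ha) hb⟩
        · exact ⟨J, hJ, Order.Ideal.sup_mem ha (hJK hb)⟩)
      (fun a b hab ⟨J, hJ, hb⟩ => ⟨J, hJ, J.lower hab hb⟩)
    refine ⟨U, ⟨?_, ?_⟩, fun z hz x hx => ⟨z, hz, hx⟩⟩
    · rw [← Order.Ideal.top_notMem_iff_ne_top]
      rintro ⟨J, hJ, htop⟩
      exact (hc hJ).1 (Order.Ideal.top_mem_iff_eq_top.1 htop)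
    · rw [h.isRound_iff]
      rintro a ⟨J, hJ, ha⟩
      obtain ⟨e, he, hae⟩ := h.isRound_iff.1 (hc hJ).2 a ha
      exact ⟨e, ⟨J, hJ, he⟩, hae⟩
  obtain ⟨M, hIM, hM⟩ := zorn_le_nonempty₀ _ chain_bound I ⟨hI, hr⟩
  exact ⟨⟨M, hM⟩, hIM⟩

end IsBooleanProximity

/-! ### Separation and compactness of the space of ends. -/

namespace BoolEnd

variable {B : Type u} [BooleanAlgebra B] {prec : B → B → Prop}

theorem top_notMem (J : BoolEnd prec) : (⊤ : B) ∉ J.1 :=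
  Order.Ideal.top_notMem_iff_ne_top.2 J.2.prop.1

theorem notMem_of_compl_mem (J : BoolEnd prec) {a : B} (ha : aᶜ ∈ J.1) : a ∉ J.1 := fun h =>
  J.top_notMem (by simpa using Order.Ideal.sup_mem h ha)

theorem exists_prec (h : IsBooleanProximity prec) (J : BoolEnd prec) {a : B} (ha : a ∈ J.1) :
    ∃ b ∈ J.1, prec a b :=
  h.isRound_iff.1 J.2.prop.2 a ha

theorem mem_or_compl_mem (h : IsBooleanProximity prec) (J : BoolEnd prec) {a b : B}
    (hab : prec a b) : a ∈ J.1 ∨ bᶜ ∈ J.1 :=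
  (h.maximal_iff.1 J.2).2 a b hab

theorem isOpen_setOf_mem (a : B) : IsOpen {J : BoolEnd prec | a ∈ J.1} :=
  TopologicalSpace.isOpen_generateFrom_of_mem ⟨a, rfl⟩

/-- By maximality some `a` lies in `I` but not in `J`. Roundness gives `a ≺ b` with `b` in `I`, and
then `J` must contain `bᶜ`; the basic sets of `b` and `bᶜ` are disjoint. -/
theorem t2Space (h : IsBooleanProximity prec) : T2Space (BoolEnd prec) := by
  refine ⟨fun I J hIJ => ?_⟩
  have : ¬ I.1 ≤ J.1 := fun hle => hIJ (Subtype.ext (le_antisymm hle (I.2.le_of_ge J.2.prop hle)))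
  obtain ⟨a, haI, haJ⟩ := Set.not_subset.1 this
  obtain ⟨b, hb, hab⟩ := I.exists_prec h haI
  refine ⟨_, _, isOpen_setOf_mem b, isOpen_setOf_mem bᶜ, hb,
    (J.mem_or_compl_mem h hab).resolve_left haJ, ?_⟩
  rw [Set.disjoint_left]
  exact fun K hK hK' => K.notMem_of_compl_mem hK' hK

/-- If `ζ(a)` belongs to the cover and `a ≺ dᶜ`, an end outside `ζ(a)` must contain `d`. The ideal
`K` generated by all such `d` is round. Were it proper, an end above it would lie in some `ζ(a)` of
the cover, hence contain some `b` with `a ≺ b`, as well as `bᶜ` from `K`. So finitely many `d` join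
to `⊤`, and no end can miss all the corresponding `ζ(a)`. -/
theorem compactSpace (h : IsBooleanProximity prec) : CompactSpace (BoolEnd prec) := by
  refine compactSpace_generateFrom rfl fun P hP hcover => ?_
  let D : Set B := {d | ∃ a, {J : BoolEnd prec | a ∈ J.1} ∈ P ∧ prec a dᶜ}
  have hbot : (∃ F : Finset B, (↑F ⊆ D) ∧ (⊥ : B) ≤ F.sup id) := ⟨∅, by simp, by simp⟩
  let K : Order.Ideal B := orderIdealOf (fun x => ∃ F : Finset B, (↑F ⊆ D) ∧ x ≤ F.sup id) hbot
    (by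
      classical
      rintro a b ⟨F, hF, haF⟩ ⟨G, hG, hbG⟩
      refine ⟨F ∪ G, by simp [hF, hG], ?_⟩
      rw [Finset.sup_union]
      exact sup_le_sup haF hbG)
    (fun a b hab ⟨F, hF, hb⟩ => ⟨F, hF, hab.trans hb⟩)
  have hround : IsRoundBoolIdeal prec K := by
    classical
    rw [h.isRound_iff]
    -- Interpolating `a ≺ c ≺ dᶜ` shows that `cᶜ` is again a generator, with `d ≺ cᶜ`.
    have step : ∀ d, ∃ d', d ∈ D → d' ∈ D ∧ prec d d' := by
      intro d
      by_cases hd : d ∈ D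
      · obtain ⟨a, ha, had⟩ := hd
        obtain ⟨c, hac, hcd⟩ := h.interpolate _ _ had
        exact ⟨cᶜ, fun _ => ⟨⟨a, ha, by simpa using hac⟩, by simpa using h.compl _ _ hcd⟩⟩
      · exact ⟨d, fun hd' => absurd hd' hd⟩
    choose f hf using step
    rintro x ⟨F, hF, hx⟩
    refine ⟨(F.image f).sup id, ⟨F.image f, ?_, le_rfl⟩, ?_⟩
    · intro y hy
      obtain ⟨d, hd, rfl⟩ := Finset.mem_image.1 (Finset.mem_coe.1 hy)
      exact (hf d (hF hd)).1
    · refine h.mono _ _ _ _ hx ?_ le_rfl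
      rw [Finset.sup_image]
      clear hx
      induction F using Finset.induction_on with
      | empty => simpa using h.bot_prec_bot
      | insert d F _ ih =>
        rw [Finset.sup_insert, Finset.sup_insert]
        exact h.sup_prec_sup (hf d (hF (by simp))).2
          (ih fun y hy => hF (by simp [Finset.mem_coe.1 hy]))
  by_cases hK : K = ⊤
  · have htop : (⊤ : B) ∈ K := by rw [hK]; trivial
    obtain ⟨F, hF, hFtop⟩ := htop
    have hF' : ∀ d ∈ F, ∃ a, {J : BoolEnd prec | a ∈ J.1} ∈ P ∧ prec a dᶜ := fun d hd => hF hd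
    choose! g hg using hF'
    refine ⟨(fun d => {J : BoolEnd prec | g d ∈ J.1}) '' (F : Set B), ?_,
      (F.finite_toSet.image _), ?_⟩
    · rintro _ ⟨d, hd, rfl⟩
      exact (hg d hd).1
    · refine Set.eq_univ_of_forall fun J => ?_
      by_contra hJ
      refine J.top_notMem (J.1.lower hFtop ((Order.Ideal.finsetSup_mem_iff _).2 fun d hd => ?_))
      have := (J.mem_or_compl_mem h (hg d hd).2).resolve_left fun hmem =>
        hJ ⟨_, ⟨d, hd, rfl⟩, hmem⟩
      simpa using this
  · exfalso
    obtain ⟨J, hJ⟩ := h.exists_end_ge hK hround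
    have : J ∈ ⋃₀ P := by rw [hcover]; trivial
    obtain ⟨V, hV, hJV⟩ := this
    obtain ⟨a, rfl⟩ := hP hV
    obtain ⟨b, hb, hab⟩ := J.exists_prec h hJV
    have : bᶜ ∈ K := ⟨{bᶜ}, by simpa [D] using ⟨a, hV, hab⟩, by simp⟩
    exact J.notMem_of_compl_mem (hJ this) hb

end BoolEnd

/-! ### Pointwise reasoning in `f`-algebras -/

/-- A lattice-preserving ring homomorphism from an `A`-algebra that is positive on `A`. -/
structure IsPoint (A : Type u) [CommRing A] [LinearOrder A] {S : Type v} [CommRing S] [Algebra A S]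
    [Lattice S] {R : Type w} [CommRing R] [LinearOrder R] (π : S →+* R) : Prop where
  map_inf : ∀ s t, π (s ⊓ t) = π s ⊓ π t
  map_sup : ∀ s t, π (s ⊔ t) = π s ⊔ π t
  map_nonneg : ∀ a : A, 0 ≤ a → 0 ≤ π (algebraMap A S a)

/-- No cancellation is needed: `e` and `1 - e` are squares, hence nonnegative, with product zero.
The smaller of the two equals its own square, which is at most that product. -/
theorem IsIdempotentElem.eq_zero_or_one_of_linearOrder {R : Type u} [CommRing R] [LinearOrder R]
    [IsOrderedRing R] {e : R} (he : IsIdempotentElem e) : e = 0 ∨ e = 1 := by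
  have he' : e * e = e := he
  have h0 : 0 ≤ e := by rw [← he']; exact mul_self_nonneg e
  have h1 : 0 ≤ 1 - e := by
    have : (1 - e) * (1 - e) = 1 - e := by linear_combination he'
    rw [← this]; exact mul_self_nonneg _
  rcases le_total e (1 - e) with h | h
  · left
    have := mul_le_mul_of_nonneg_left h h0
    refine le_antisymm ?_ h0
    calc e = e * e := he'.symm
      _ ≤ e * (1 - e) := this
      _ = 0 := by linear_combination -he'
  · right
    have := mul_le_mul_of_nonneg_left h h1
    have h2 : 1 - e ≤ 0 := by
      calc 1 - e = (1 - e) * (1 - e) := by linear_combination -he'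
        _ ≤ (1 - e) * e := this
        _ = 0 := by linear_combination -he'
    exact (sub_eq_zero.1 (le_antisymm h2 h1)).symm

namespace IsPoint

theorem map_smul {A : Type u} [CommRing A] {S : Type v} [CommRing S] [Algebra A S] {R : Type w}
    [CommRing R] (π : S →+* R) (a : A) (s : S) : π (a • s) = π (algebraMap A S a) * π s := by
  rw [Algebra.smul_def, map_mul]

theorem map_idem {S : Type v} [CommRing S] {R : Type w} [CommRing R] [LinearOrder R]
    [IsOrderedRing R] (π : S →+* R) (e : Idem S) : π e.1 = 0 ∨ π e.1 = 1 :=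
  (e.2.map π).eq_zero_or_one_of_linearOrder

variable {A : Type u} [CommRing A] [LinearOrder A] {S : Type v} [CommRing S]
  [Algebra A S] [Lattice S] {R : Type w} [CommRing R] [LinearOrder R] {π : S →+* R}

theorem mono (h : IsPoint A π) {s t : S} (hst : s ≤ t) : π s ≤ π t := by
  have := h.map_inf s t
  rw [inf_eq_left.2 hst] at this
  exact inf_eq_left.1 this.symm

theorem map_abs (h : IsPoint A π) (s : S) : π |s| = |π s| := by
  change π (s ⊔ -s) = π s ⊔ -π s
  rw [h.map_sup, map_neg]

theorem algebraMap_mono [IsOrderedRing A] [IsOrderedRing R] (h : IsPoint A π) {a b : A}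
    (hab : a ≤ b) : π (algebraMap A S a) ≤ π (algebraMap A S b) := by
  have := h.map_nonneg (b - a) (sub_nonneg.2 hab)
  rwa [map_sub, map_sub, sub_nonneg] at this

end IsPoint

/-- The factors of the subdirect representation are quotients of `S`, so they inherit commutativity
and become ordered commutative rings; jointly they detect the order of `S`. -/
theorem IsTorsionFreeFAlgebra.le_of_points {A : Type u} [CommRing A] [LinearOrder A]
    {S : Type v} [CommRing S] [Algebra A S] [Lattice S] (hS : IsTorsionFreeFAlgebra A S) {s t : S}
    (H : ∀ (R : Type v) [CommRing R] [LinearOrder R] [IsOrderedRing R] (π : S →+* R),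
      IsPoint A π → π s ≤ π t) : s ≤ t := by
  obtain ⟨ι, R, rR, oR, π, hR, hsurj, hinf, hsup, hinj⟩ := hS.subdirect
  refine inf_eq_left.1 (hinj _ _ fun i => ?_)
  rw [hinf, inf_eq_left]
  let cR : CommRing (R i) :=
    { rR i with
      mul_comm := fun a b => by
        obtain ⟨x, rfl⟩ := hsurj i a
        obtain ⟨y, rfl⟩ := hsurj i b
        rw [← map_mul, mul_comm, map_mul] }
  have : IsOrderedAddMonoid (R i) :=
    { add_le_add_left := fun a b hab c => (hR i).add_le_add_right a b c hab }
  have h01 : (0 : R i) ≤ 1 := by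
    rcases le_total (0 : R i) 1 with h | h
    · exact h
    · have := (hR i).mul_nonneg (-1) (-1) (neg_nonneg.2 h) (neg_nonneg.2 h)
      simpa using this
  have : ZeroLEOneClass (R i) := ⟨h01⟩
  have : IsOrderedRing (R i) := IsOrderedRing.of_mul_nonneg (hR i).mul_nonneg
  refine H (R i) (π i) ⟨hinf i, hsup i, fun a ha => ?_⟩
  -- Positivity of a scalar in `S` is that of `a • 1`, so it rests on `0 ≤ 1`, itself checked in the
  -- factors.
  have h1 : (0 : S) ≤ 1 := by
    refine inf_eq_left.1 (hinj _ _ fun j => ?_)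
    rw [hinf, inf_eq_left, map_zero, map_one]
    rcases le_total (0 : R j) 1 with h | h
    · exact h
    · have h' : (0 : R j) ≤ -1 := by
        have := (hR j).add_le_add_right _ _ (-1) h
        simpa using this
      have := (hR j).mul_nonneg (-1) (-1) h' h'
      simpa using this
  have h2 := hS.smul_nonneg a 1 ha h1
  rw [← Algebra.algebraMap_eq_smul_one] at h2
  have h3 := hinf i 0 (algebraMap A S a)
  rw [inf_eq_left.2 h2, map_zero] at h3
  exact inf_eq_left.1 h3.symm

section

/-! ### Idempotents and supports in Specker algebras -/

namespace Idem

variable {S : Type u} [CommRing S]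

theorem val_inf (e k : Idem S) : (e ⊓ k).1 = e.1 * k.1 := rfl
theorem val_sup (e k : Idem S) : (e ⊔ k).1 = e.1 + k.1 - e.1 * k.1 := rfl
theorem val_compl (e : Idem S) : (eᶜ).1 = 1 - e.1 := rfl
theorem val_top : (⊤ : Idem S).1 = 1 := rfl
theorem val_bot : (⊥ : Idem S).1 = 0 := rfl
theorem le_iff_mul {e k : Idem S} : e ≤ k ↔ e.1 * k.1 = e.1 := Iff.rfl
theorem mul_self (e : Idem S) : e.1 * e.1 = e.1 := e.2

end Idem

/-! ### Pointwise inequalities for joining supports. -/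

section ZeroOne

variable {R : Type u} [CommRing R] [LinearOrder R] {x y e k s : R}

theorem min_mul_sup_le {a b m : R} (hx : x = 0 ∨ x = 1) (hy : y = 0 ∨ y = 1) (he : e = 0 ∨ e = 1)
    (hk : k = 0 ∨ k = 1) (hma : m ≤ a) (hmb : m ≤ b) (hs : 0 ≤ s) (hxs : a * e ≤ x * s)
    (hys : b * k ≤ y * s) : m * (e + k - e * k) ≤ (x + y - x * y) * s := by
  have hle : x * s ≤ (x + y - x * y) * s ∧ y * s ≤ (x + y - x * y) * s := by
    rcases hx with rfl | rfl <;> rcases hy with rfl | rfl <;> simp [hs]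
  have hnonneg : 0 ≤ (x + y - x * y) * s := by
    rcases hx with rfl | rfl <;> rcases hy with rfl | rfl <;> simp [hs]
  rcases he with rfl | rfl <;> rcases hk with rfl | rfl
  · simpa using hnonneg
  · simpa using hmb.trans ((by simpa using hys : b ≤ y * s).trans hle.2)
  · simpa using hma.trans ((by simpa using hxs : a ≤ x * s).trans hle.1)
  · simpa using hma.trans ((by simpa using hxs : a ≤ x * s).trans hle.1)

theorem sup_mul_le_add_mul [IsOrderedRing R] {a b : R} (hx : x = 0 ∨ x = 1) (hy : y = 0 ∨ y = 1)
    (he : e = 0 ∨ e = 1) (hk : k = 0 ∨ k = 1) (ha : 0 ≤ a) (hb : 0 ≤ b) (hs : 0 ≤ s)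
    (hxs : x * s ≤ a * e) (hys : y * s ≤ b * k) :
    (x + y - x * y) * s ≤ (a + b) * (e + k - e * k) := by
  have h1 : (x + y - x * y) * s ≤ x * s + y * s := by
    rcases hx with rfl | rfl <;> rcases hy with rfl | rfl <;> simp [hs]
  have h2 : a * e + b * k ≤ (a + b) * (e + k - e * k) := by
    rcases he with rfl | rfl <;> rcases hk with rfl | rfl <;> simp [ha, hb]
  exact h1.trans ((add_le_add hxs hys).trans h2)

end ZeroOne

/-- A property of idempotents that is closed under joins holds for `⊤` as soon as it holds for the
idempotents on which a given element of a Specker algebra is constant. -/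
theorem IsSpecker.induction {A : Type u} [CommRing A] {S : Type v} [CommRing S] [Algebra A S]
    (hS : IsSpecker A S) (s : S) {Q : Idem S → Prop}
    (const : ∀ (e : Idem S) (a : A), e.1 * s = a • e.1 → Q e)
    (sup : ∀ e k, Q e → Q k → Q (e ⊔ k)) : Q ⊤ := by
  obtain ⟨B, -, hB⟩ := hS
  have hs : s ∈ Algebra.adjoin A {s : S | ∃ e ∈ B, e.1 = s} := by rw [hB]; trivial
  -- The property must vary in the induction: for a sum or product, once `x` is constant on `e`, the
  -- hypothesis for `y` is applied to `k ↦ Q (e ⊓ k)`, and both factors are constant on `e ⊓ k`.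
  suffices ∀ Q : Idem S → Prop, (∀ (e : Idem S) (a : A), e.1 * s = a • e.1 → Q e) →
      (∀ e k, Q e → Q k → Q (e ⊔ k)) → Q ⊤ from this Q const sup
  refine Algebra.adjoin_induction (p := fun s _ => ∀ Q : Idem S → Prop,
    (∀ (e : Idem S) (a : A), e.1 * s = a • e.1 → Q e) → (∀ e k, Q e → Q k → Q (e ⊔ k)) → Q ⊤)
    ?_ ?_ ?_ ?_ hs
  · rintro _ ⟨e, -, rfl⟩ Q const sup
    rw [← sup_compl_eq_top (x := e)]
    refine sup _ _ (const e 1 (by rw [one_smul, e.mul_self])) (const eᶜ 0 ?_)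
    rw [Idem.val_compl, zero_smul]
    linear_combination -e.mul_self
  · intro r Q const _
    exact const ⊤ r (by rw [Idem.val_top, one_mul, Algebra.algebraMap_eq_smul_one])
  · intro x y _ _ hx hy Q const sup
    refine hx Q (fun e a hea => ?_) sup
    have := hy (fun k => Q (e ⊓ k)) (fun k b hkb => const _ (a + b) ?_)
      (fun k l hk hl => by rw [inf_sup_left]; exact sup _ _ hk hl)
    · simpa using this
    · rw [Algebra.smul_def] at *
      rw [Idem.val_inf, map_add]
      linear_combination k.1 * hea + e.1 * hkb
  · intro x y _ _ hx hy Q const sup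
    refine hx Q (fun e a hea => ?_) sup
    have := hy (fun k => Q (e ⊓ k)) (fun k b hkb => const _ (a * b) ?_)
      (fun k l hk hl => by rw [inf_sup_left]; exact sup _ _ hk hl)
    · simpa using this
    · rw [Algebra.smul_def] at *
      rw [Idem.val_inf, map_mul]
      calc e.1 * k.1 * (x * y) = (e.1 * x) * (k.1 * y) := by ring
        _ = _ := by rw [hea, hkb]; ring

variable {A : Type u} [CommRing A] [LinearOrder A] {S : Type v} [CommRing S] [Algebra A S]
  [Lattice S]

namespace IsTorsionFreeFAlgebra

theorem idem_nonneg (hS : IsTorsionFreeFAlgebra A S) (e : Idem S) : 0 ≤ e.1 :=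
  hS.le_of_points fun R _ _ _ π _ => by
    rcases IsPoint.map_idem π e with h | h <;> simp [h]

theorem idem_le_iff (hS : IsTorsionFreeFAlgebra A S) {e k : Idem S} : e ≤ k ↔ e.1 ≤ k.1 := by
  rw [Idem.le_iff_mul]
  constructor
  · intro h
    refine hS.le_of_points fun R _ _ _ π _ => ?_
    rw [← h, map_mul]
    rcases IsPoint.map_idem π e with h | h <;> rcases IsPoint.map_idem π k with h' | h' <;>
      simp [h, h']
  · intro hle
    apply le_antisymm <;> refine hS.le_of_points fun R _ _ _ π hπ => ?_ <;>
    · have := hπ.mono hle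
      rw [map_mul]
      rcases IsPoint.map_idem π e with h | h <;> rcases IsPoint.map_idem π k with h' | h' <;>
        simp_all

theorem smul_idem_eq_zero (hS : IsTorsionFreeFAlgebra A S) {a : A} (ha : a ≠ 0) {e : Idem S}
    (h : a • e.1 = 0) : e = ⊥ :=
  Subtype.ext ((hS.torsion_free a e.1 h).resolve_left ha)

theorem eq_bot_of_smul_idem_nonpos (hS : IsTorsionFreeFAlgebra A S) {a : A} (ha : 0 < a)
    {e : Idem S} (h : a • e.1 ≤ 0) : e = ⊥ :=
  hS.smul_idem_eq_zero ha.ne' (le_antisymm h (hS.smul_nonneg a e.1 ha.le (hS.idem_nonneg e)))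

theorem smul_idem_mono [IsOrderedRing A] (hS : IsTorsionFreeFAlgebra A S) {a b : A}
    (hab : a ≤ b) (e : Idem S) :
    a • e.1 ≤ b • e.1 :=
  hS.le_of_points fun R _ _ _ π hπ => by
    rw [IsPoint.map_smul, IsPoint.map_smul]
    exact mul_le_mul_of_nonneg_right (hπ.algebraMap_mono hab)
      (by rcases IsPoint.map_idem π e with h | h <;> simp [h])

variable [IsDomain A] [IsOrderedRing A]

/-- There are finitely many values to bound; when pieces are joined, the sum of the two bounds
serves for both. -/
theorem exists_abs_le (hS : IsTorsionFreeFAlgebra A S) (hsp : IsSpecker A S) (s : S) :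
    ∃ b : A, 0 < b ∧ |s| ≤ b • 1 := by
  suffices h : ∃ b : A, 0 < b ∧ (⊤ : Idem S).1 * |s| ≤ b • 1 by
    simpa only [Idem.val_top, one_mul] using h
  refine hsp.induction s (Q := fun e => ∃ b : A, 0 < b ∧ e.1 * |s| ≤ b • 1) ?_ ?_
  · intro e a hea
    refine ⟨|a| + 1, by positivity, hS.le_of_points fun R _ _ _ π hπ => ?_⟩
    have h1 := congrArg π hea
    rw [IsPoint.map_smul, map_mul] at *
    have h2 := hπ.algebraMap_mono (le_abs_self a)
    have h3 := hπ.algebraMap_mono (neg_le_abs a)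
    have h4 := hπ.map_nonneg |a| (abs_nonneg a)
    rw [hπ.map_abs, map_add, map_add, map_one, map_one]
    rw [map_neg, map_neg] at h3
    rcases IsPoint.map_idem π e with h | h
    · rw [h, zero_mul]; grind [zero_le_one (α := R)]
    · rw [h, one_mul, mul_one] at h1
      rw [h, h1, one_mul, mul_one]
      have := abs_le'.2 ⟨h2, h3⟩
      grind [zero_le_one (α := R)]
  · rintro e k ⟨a, ha, hea⟩ ⟨b, hb, hkb⟩
    refine ⟨a + b, add_pos ha hb, hS.le_of_points fun R _ _ _ π hπ => ?_⟩
    have h1 := hπ.mono hea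
    have h2 := hπ.mono hkb
    have h3 : (0 : R) ≤ π |s| := by rw [hπ.map_abs]; exact abs_nonneg _
    have ha' := hπ.map_nonneg a ha.le
    have hb' := hπ.map_nonneg b hb.le
    rw [Idem.val_sup]
    simp only [IsPoint.map_smul, map_mul, map_add, map_sub, map_one] at *
    simpa using sup_mul_le_add_mul (IsPoint.map_idem π e) (IsPoint.map_idem π k) (.inr rfl)
      (.inr rfl) ha' hb' h3 h1 h2

/-- The support is the join of the pieces on which `s` has a positive value. When pieces are joined,
the lower scalar becomes the minimum and the upper one the sum. -/
theorem exists_support (hS : IsTorsionFreeFAlgebra A S) (hsp : IsSpecker A S) {s : S}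
    (hs : 0 ≤ s) : ∃ (e : Idem S) (a b : A), 0 < a ∧ 0 < b ∧ a • e.1 ≤ s ∧ s ≤ b • e.1 := by
  suffices h : ∃ (e : Idem S) (a b : A), 0 < a ∧ 0 < b ∧ a • e.1 ≤ (⊤ : Idem S).1 * s ∧
      (⊤ : Idem S).1 * s ≤ b • e.1 by
    simpa only [Idem.val_top, one_mul] using h
  refine hsp.induction s (Q := fun k => ∃ (e : Idem S) (a b : A), 0 < a ∧ 0 < b ∧
    a • e.1 ≤ k.1 * s ∧ k.1 * s ≤ b • e.1) ?_ ?_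
  · intro e a hea
    rcases lt_or_ge 0 a with ha | ha
    · exact ⟨e, a, a, ha, ha, hea.ge, hea.le⟩
    -- A value `a ≤ 0` of a nonnegative element contributes nothing, so the piece has empty support
    -- and the scalars are arbitrary.
    · refine ⟨⊥, 1, 1, one_pos, one_pos, ?_, ?_⟩
      · rw [Idem.val_bot, smul_zero]
        exact hS.mul_nonneg _ _ (hS.idem_nonneg e) hs
      · rw [hea, Idem.val_bot, smul_zero]
        simpa using hS.smul_idem_mono ha e
  · rintro x y ⟨e, a, b, ha, hb, hae, heb⟩ ⟨k, a', b', ha', hb', hak, hkb⟩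
    refine ⟨e ⊔ k, min a a', b + b', lt_min ha ha', add_pos hb hb',
      hS.le_of_points fun R _ _ _ π hπ => ?_, hS.le_of_points fun R _ _ _ π hπ => ?_⟩
    · have h1 := hπ.mono hae
      have h2 := hπ.mono hak
      have h5 := hπ.mono hs
      rw [Idem.val_sup, Idem.val_sup]
      simp only [IsPoint.map_smul, map_mul, map_add, map_sub, map_zero] at *
      exact min_mul_sup_le (IsPoint.map_idem π x) (IsPoint.map_idem π y) (IsPoint.map_idem π e)
        (IsPoint.map_idem π k) (hπ.algebraMap_mono (min_le_left a a'))
        (hπ.algebraMap_mono (min_le_right a a')) h5 h1 h2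
    · have h1 := hπ.mono heb
      have h2 := hπ.mono hkb
      have h5 := hπ.mono hs
      rw [Idem.val_sup, Idem.val_sup]
      simp only [IsPoint.map_smul, map_mul, map_add, map_sub, map_zero] at *
      exact sup_mul_le_add_mul (IsPoint.map_idem π x) (IsPoint.map_idem π y)
        (IsPoint.map_idem π e) (IsPoint.map_idem π k) (hπ.map_nonneg b hb.le)
        (hπ.map_nonneg b' hb'.le) h5 h1 h2

end IsTorsionFreeFAlgebra

/-! ### Restricting the proximity to idempotents. -/

namespace IsProximitySpecker

variable {prec : S → S → Prop}

/-- From `a • e ≺ t` and `a • e ≤ a • 1 ≺ a • 1` follows `a • e ≺ t ⊓ a • 1`. This meet is at most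
`a • k`: where `k` is 0 so is the bound on `t`, and where `k` is 1 the truncation at `a` applies.
Then `a` cancels. -/
theorem prec_of_smul_le (hS : IsProximitySpecker A prec) {e k : Idem S} {s t : S} {a b : A}
    (ha : 0 < a) (hes : a • e.1 ≤ s) (hst : prec s t) (htk : t ≤ b • k.1) :
    idemRel prec e k := by
  have hF := hS.fAlgebra
  have hP := hS.proximity
  have h1 : prec (a • e.1) t := hP.mono _ _ _ _ hes hst le_rfl
  have h2 : prec (a • e.1) (a • 1) := by
    refine hP.mono _ _ _ _ ?_ (hP.smul a 1 1 ha hP.one_prec_one) le_rfl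
    refine hF.le_of_points fun R _ _ _ π hπ => ?_
    have := hπ.map_nonneg a ha.le
    rw [IsPoint.map_smul, IsPoint.map_smul]
    rcases IsPoint.map_idem π e with h | h <;> simp [h, this]
  refine hP.of_smul a _ _ ha (hP.mono _ _ _ _ le_rfl (hP.prec_inf _ _ _ h1 h2) ?_)
  refine hF.le_of_points fun R _ _ _ π hπ => ?_
  have h3 := hπ.mono htk
  rw [hπ.map_inf]
  rw [IsPoint.map_smul] at h3
  rcases IsPoint.map_idem π k with h | h
  · rw [h, mul_zero] at h3
    rw [IsPoint.map_smul, IsPoint.map_smul, h, mul_zero]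
    exact inf_le_left.trans h3
  · rw [IsPoint.map_smul, IsPoint.map_smul, h, map_one]
    exact inf_le_right

variable [IsDomain A] [IsOrderedRing A]

theorem isBooleanProximity (hS : IsProximitySpecker A prec) :
    IsBooleanProximity (idemRel prec) := by
  have hF := hS.fAlgebra
  have hP := hS.proximity
  refine ⟨hP.one_prec_one, fun a b h => hF.idem_le_iff.2 (hP.le_of_prec _ _ h),
    fun a b c d h1 h2 h3 => hP.mono _ _ _ _ (hF.idem_le_iff.1 h1) h2 (hF.idem_le_iff.1 h3), ?_, ?_, ?_, ?_⟩
  · intro a b c hab hac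
    refine hP.mono _ _ _ _ le_rfl (hP.prec_inf _ _ _ hab hac) ?_
    refine hF.le_of_points fun R _ _ _ π hπ => ?_
    rw [hπ.map_inf, Idem.val_inf, map_mul]
    rcases IsPoint.map_idem π b with h | h <;> rcases IsPoint.map_idem π c with h' | h' <;>
      simp [h, h']
  · intro a b hab
    have := hP.add _ _ _ _ hP.one_prec_one (hP.neg _ _ hab)
    simpa only [idemRel, Idem.val_compl, sub_eq_add_neg] using this
  · intro e k hek
    obtain ⟨s, hes, hsk⟩ := hP.interpolate _ _ hek
    have hle := hP.le_of_prec _ _ hes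
    obtain ⟨r, a, b, ha, hb, har, hrb⟩ :=
      hF.exists_support hS.specker ((hF.idem_nonneg e).trans hle)
    exact ⟨r, hS.prec_of_smul_le one_pos (one_smul A e.1).le hes hrb,
      hS.prec_of_smul_le ha har hsk (one_smul A k.1).ge⟩
  · intro e he
    -- Density in `S` supplies a positive `t ≺ e`; its support is nonzero because a multiple of it
    -- dominates `t`.
    have hpos : 0 < e.1 := lt_of_le_of_ne (hF.idem_nonneg e) fun h => he (Subtype.ext h.symm)
    obtain ⟨t, ht, hte⟩ := hP.exists_prec _ hpos
    obtain ⟨k, a, b, ha, hb, hak, hkb⟩ := hF.exists_support hS.specker ht.le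
    refine ⟨k, ?_, hS.prec_of_smul_le ha hak hte (one_smul A e.1).ge⟩
    rintro rfl
    rw [Idem.val_bot, smul_zero] at hkb
    exact ht.not_ge hkb

end IsProximitySpecker

end

section

/-! ### The ends of a proximity Specker algebra -/

variable {A : Type u} [CommRing A] [LinearOrder A] {S : Type v} [CommRing S] [Algebra A S]
  [Lattice S]

theorem IsTorsionFreeFAlgebra.eq_of_points (hS : IsTorsionFreeFAlgebra A S) {s t : S}
    (H : ∀ (R : Type v) [CommRing R] [LinearOrder R] [IsOrderedRing R] (π : S →+* R),
      IsPoint A π → π s = π t) : s = t :=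
  le_antisymm (hS.le_of_points fun R _ _ _ π hπ => (H R π hπ).le)
    (hS.le_of_points fun R _ _ _ π hπ => (H R π hπ).ge)

theorem IsTorsionFreeFAlgebra.abs_nonneg (hS : IsTorsionFreeFAlgebra A S) (s : S) : 0 ≤ |s| :=
  hS.le_of_points fun R _ _ _ π hπ => by
    rw [hπ.map_abs, map_zero]
    exact _root_.abs_nonneg _

theorem IsTorsionFreeFAlgebra.abs_of_nonneg (hS : IsTorsionFreeFAlgebra A S) {s : S}
    (hs : 0 ≤ s) : |s| = s :=
  hS.eq_of_points fun R _ _ _ π hπ => by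
    rw [hπ.map_abs, _root_.abs_of_nonneg]
    simpa using hπ.mono hs

theorem IsTorsionFreeFAlgebra.le_abs_self (hS : IsTorsionFreeFAlgebra A S) (s : S) : s ≤ |s| :=
  hS.le_of_points fun R _ _ _ π hπ => by
    rw [hπ.map_abs]
    exact _root_.le_abs_self _

/-- The idempotent `e` is the support of `s`. -/
def IsSupport (A : Type u) [CommRing A] [LinearOrder A] {S : Type v} [CommRing S] [Algebra A S]
    [Lattice S] (e : Idem S) (s : S) : Prop :=
  ∃ a b : A, 0 < a ∧ 0 < b ∧ a • e.1 ≤ |s| ∧ |s| ≤ b • e.1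

theorem IsTorsionFreeFAlgebra.exists_isSupport [IsDomain A] [IsOrderedRing A]
    (hS : IsTorsionFreeFAlgebra A S) (hsp : IsSpecker A S) (s : S) :
    ∃ e : Idem S, IsSupport A e s :=
  hS.exists_support hsp (hS.abs_nonneg s)

/-- The multiplication by `e` fixes every element that it dominates. -/
theorem IsTorsionFreeFAlgebra.idem_mul_eq_of_abs_le (hS : IsTorsionFreeFAlgebra A S) {e : Idem S}
    {s t : S} (h : |s| ≤ |t|) (ht : e.1 * t = t) : e.1 * s = s :=
  hS.eq_of_points fun R _ _ _ π hπ => by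
    have h1 := hπ.mono h
    have h2 := congrArg π ht
    rw [hπ.map_abs, hπ.map_abs] at h1
    rw [map_mul] at *
    rcases IsPoint.map_idem π e with h' | h'
    · rw [h', zero_mul] at h2
      rw [← h2, abs_zero] at h1
      rw [abs_nonpos_iff.1 h1, mul_zero]
    · rw [h', one_mul]

theorem IsTorsionFreeFAlgebra.abs_smul_idem (hS : IsTorsionFreeFAlgebra A S) {a : A} (ha : 0 ≤ a)
    (e : Idem S) : |a • e.1| = a • e.1 :=
  hS.abs_of_nonneg (hS.smul_nonneg a e.1 ha (hS.idem_nonneg e))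

theorem IsSupport.mul_eq (hS : IsTorsionFreeFAlgebra A S) {e : Idem S} {s : S}
    (h : IsSupport A e s) : e.1 * s = s := by
  obtain ⟨a, b, ha, hb, h1, h2⟩ := h
  refine hS.idem_mul_eq_of_abs_le (t := b • e.1) ?_ (by rw [mul_smul_comm, e.mul_self])
  rwa [hS.abs_smul_idem hb.le]

/-- With `IsSupport.mul_eq`, this makes the support the least idempotent fixing `s`. An idempotent
`k` fixing `s` also fixes the dominated `a • e`, so `a • (e ⊓ kᶜ) = 0` and torsion-freeness applies.
-/
theorem IsSupport.le (hS : IsTorsionFreeFAlgebra A S) {e k : Idem S} {s : S}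
    (h : IsSupport A e s) (hk : k.1 * s = s) : e ≤ k := by
  obtain ⟨a, b, ha, hb, h1, h2⟩ := h
  have : k.1 * (a • e.1) = a • e.1 :=
    hS.idem_mul_eq_of_abs_le (by rwa [hS.abs_smul_idem ha.le]) hk
  have h0 : a • (e ⊓ kᶜ).1 = 0 := by
    rw [Idem.val_inf, Idem.val_compl]
    rw [Algebra.smul_def] at *
    linear_combination -this
  have := hS.smul_idem_eq_zero ha.ne' h0
  rwa [← disjoint_iff, disjoint_compl_right_iff] at this

/-- The elements of `S` supported on an element of a Boolean ideal. -/
def idealOfIdem {S : Type v} [CommRing S] (J : Order.Ideal (Idem S)) : Ideal S where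
  carrier := {s | ∃ e ∈ J, e.1 * s = s}
  zero_mem' := ⟨⊥, J.bot_mem, mul_zero _⟩
  add_mem' := by
    rintro s t ⟨e, he, hs⟩ ⟨k, hk, ht⟩
    refine ⟨e ⊔ k, Order.Ideal.sup_mem he hk, ?_⟩
    rw [Idem.val_sup]
    linear_combination (1 - k.1) * hs + (1 - e.1) * ht
  smul_mem' := by
    rintro c s ⟨e, he, hs⟩
    refine ⟨e, he, ?_⟩
    rw [smul_eq_mul]
    linear_combination c * hs

theorem idealOfIdem_mono {S : Type v} [CommRing S] {J K : Order.Ideal (Idem S)} (h : J ≤ K) :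
    idealOfIdem J ≤ idealOfIdem K := fun _ ⟨e, he, hes⟩ => ⟨e, h he, hes⟩

/-- The idempotents with a positive multiple in a given ideal. -/
def idemOfIdeal (A : Type u) [CommRing A] [LinearOrder A] [IsDomain A] [IsOrderedRing A]
    {S : Type v} [CommRing S] [Algebra A S] (I : Ideal S) : Order.Ideal (Idem S) :=
  orderIdealOf (fun e => ∃ a : A, 0 < a ∧ a • e.1 ∈ I)
    ⟨1, one_pos, by rw [Idem.val_bot, smul_zero]; exact I.zero_mem⟩
    (by
      rintro e k ⟨a, ha, hea⟩ ⟨b, hb, hkb⟩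
      have : IsStrictOrderedRing A := IsOrderedRing.toIsStrictOrderedRing A
      -- The common multiplier comes from `ab(e ∨ k) = b(ae) + a(1 - e)(bk)`.
      refine ⟨a * b, mul_pos ha hb, ?_⟩
      have h := I.add_mem (I.mul_mem_left (algebraMap A S b) hea)
        (I.mul_mem_left (algebraMap A S a * (1 - e.1)) hkb)
      rw [Algebra.smul_def] at *
      rw [Idem.val_sup]
      convert h using 1
      rw [map_mul, Algebra.smul_def]
      ring)
    (by
      rintro e k hek ⟨a, ha, hka⟩
      refine ⟨a, ha, ?_⟩
      rw [← Idem.le_iff_mul.1 hek, ← mul_smul_comm]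
      exact I.mul_mem_left _ hka)

theorem IsTorsionFreeFAlgebra.smul_mem_idealOfIdem_iff (hS : IsTorsionFreeFAlgebra A S)
    {J : Order.Ideal (Idem S)} {a : A} (ha : a ≠ 0) {k : Idem S} :
    a • k.1 ∈ idealOfIdem J ↔ k ∈ J := by
  constructor
  · rintro ⟨e, he, h⟩
    have h0 : a • (k ⊓ eᶜ).1 = 0 := by
      rw [Idem.val_inf, Idem.val_compl]
      rw [Algebra.smul_def] at *
      linear_combination -h
    have := hS.smul_idem_eq_zero ha h0
    rw [← disjoint_iff, disjoint_compl_right_iff] at this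
    exact J.lower this he
  · exact fun hk => ⟨k, hk, by rw [mul_smul_comm, k.mul_self]⟩

theorem IsSupport.mem_idealOfIdem_iff (hS : IsTorsionFreeFAlgebra A S)
    {J : Order.Ideal (Idem S)} {e : Idem S} {s : S} (h : IsSupport A e s) :
    s ∈ idealOfIdem J ↔ e ∈ J :=
  ⟨fun ⟨_, hk, hks⟩ => J.lower (h.le hS hks) hk, fun he => ⟨e, he, h.mul_eq hS⟩⟩

/-! ### Round ideals of the algebra against round ideals of idempotents. -/

namespace IsProximitySpecker

variable {prec : S → S → Prop} [IsDomain A] [IsOrderedRing A]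

theorem idemOfIdeal_idealOfIdem (hS : IsProximitySpecker A prec) (J : Order.Ideal (Idem S)) :
    idemOfIdeal A (idealOfIdem J) = J := by
  ext e
  constructor
  · rintro ⟨a, ha, h⟩
    exact (hS.fAlgebra.smul_mem_idealOfIdem_iff ha.ne').1 h
  · exact fun he => ⟨1, one_pos, (hS.fAlgebra.smul_mem_idealOfIdem_iff one_ne_zero).2 he⟩

theorem isRound_idealOfIdem (hS : IsProximitySpecker A prec) {J : Order.Ideal (Idem S)}
    (hJ : J ≠ ⊤ ∧ IsRoundBoolIdeal (idemRel prec) J) :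
    idealOfIdem J ≠ ⊤ ∧ IsRoundIdeal A prec (idealOfIdem J) := by
  have hF := hS.fAlgebra
  have hP := hS.proximity
  have htop := Order.Ideal.top_notMem_iff_ne_top.2 hJ.1
  have hl : IsLIdeal (idealOfIdem J) := fun s t hst ⟨e, he, het⟩ =>
    ⟨e, he, hF.idem_mul_eq_of_abs_le hst het⟩
  refine ⟨?_, hl, Or.inr ⟨?_, ?_⟩⟩
  · rw [Ne, Ideal.eq_top_iff_one]
    exact fun h => htop ((hF.smul_mem_idealOfIdem_iff (a := (1 : A)) one_ne_zero (k := ⊤)).1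
      (by rwa [one_smul]))
  · ext s
    constructor
    · rintro ⟨t, ht, hst⟩
      exact hl s t ((hP.le_of_prec _ _ hst).trans (hF.le_abs_self t)) ht
    · rintro ⟨e, he, hes⟩
      obtain ⟨k, hk, hek⟩ := hS.isBooleanProximity.isRound_iff.1 hJ.2 e he
      obtain ⟨c, hc, hsc⟩ := hF.exists_abs_le hS.specker s
      -- With `|s| ≤ c` and `s` supported on `e ≺ k`, one has `|s| ≤ c • e ≺ c • k`.
      refine ⟨c • k.1, (hF.smul_mem_idealOfIdem_iff hc.ne').2 hk,
        hP.mono _ _ _ _ ?_ (hP.smul c _ _ hc hek) le_rfl⟩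
      refine hF.le_of_points fun R _ _ _ π hπ => ?_
      have h1 := hπ.mono hsc
      have h2 := congrArg π hes
      rw [IsPoint.map_smul, hπ.map_abs] at *
      rw [map_mul] at h2
      rcases IsPoint.map_idem π e with h | h
      · rw [h, zero_mul] at h2
        rw [← h2, h, abs_zero, mul_zero]
      · rwa [h, ← map_one π]
  · rintro a ⟨e, he, hea⟩
    by_contra ha
    have ha' : a ≠ 0 := fun h => ha (by rw [h, map_zero])
    have h0 : a • (eᶜ).1 = 0 := by
      rw [Idem.val_compl, Algebra.smul_def]
      linear_combination -hea
    have := hF.smul_idem_eq_zero ha' h0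
    rw [compl_eq_bot] at this
    exact htop (this ▸ he)

/-- A positive multiple of the support of `s` lies below `|s|`, hence in the `ℓ`-ideal. Only this
inclusion is formal, since an `ℓ`-ideal may contain `a • e` but not `e`; for ends, maximality
supplies the other. -/
theorem le_idealOfIdem_idemOfIdeal (hS : IsProximitySpecker A prec) {I : Ideal S}
    (hI : IsLIdeal I) : I ≤ idealOfIdem (idemOfIdeal A I) := by
  intro s hs
  obtain ⟨e, he⟩ := hS.fAlgebra.exists_isSupport hS.specker s
  refine ⟨e, ?_, he.mul_eq hS.fAlgebra⟩
  obtain ⟨a, b, ha, hb, h1, h2⟩ := he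
  exact ⟨a, ha, hI _ s (by rwa [hS.fAlgebra.abs_smul_idem ha.le]) hs⟩

theorem isRound_idemOfIdeal (hS : IsProximitySpecker A prec) {I : Ideal S}
    (hI : I ≠ ⊤ ∧ IsRoundIdeal A prec I) :
    idemOfIdeal A I ≠ ⊤ ∧ IsRoundBoolIdeal (idemRel prec) (idemOfIdeal A I) := by
  have hF := hS.fAlgebra
  obtain ⟨hr, hA⟩ := hI.2.2.resolve_left hI.1
  constructor
  · rw [← Order.Ideal.top_notMem_iff_ne_top]
    -- Properness rests on `I ∩ A = 0`: a positive multiple of 1 in `I` would vanish, forcing `1 =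
    -- 0` in `S`.
    rintro ⟨a, ha, h⟩
    rw [Idem.val_top, ← Algebra.algebraMap_eq_smul_one] at h
    have h0 := hA a h
    rw [Algebra.algebraMap_eq_smul_one] at h0
    have := (hF.torsion_free _ _ h0).resolve_left ha.ne'
    exact hI.1 ((Ideal.eq_top_iff_one I).2 (this ▸ I.zero_mem))
  · rw [hS.isBooleanProximity.isRound_iff]
    rintro e ⟨a, ha, h⟩
    have h' : a • e.1 ∈ {s : S | ∃ t ∈ I, prec |s| t} := by rw [hr]; exact h
    obtain ⟨t, ht, hat⟩ := h'
    rw [hF.abs_smul_idem ha.le] at hat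
    obtain ⟨k, hk⟩ := hF.exists_isSupport hS.specker t
    refine ⟨k, ?_, ?_⟩
    · obtain ⟨c, b, hc, hb, h1, h2⟩ := hk
      exact ⟨c, hc, hI.2.1 _ t (by rwa [hF.abs_smul_idem hc.le]) ht⟩
    · obtain ⟨c, b, hc, hb, h1, h2⟩ := hk
      exact hS.prec_of_smul_le ha le_rfl hat ((hF.le_abs_self t).trans h2)

/-- A larger proper round `I` yields a proper round ideal of idempotents containing `J`, hence equal
to `J`, and `I` consists of elements supported in it. -/
theorem maximal_idealOfIdem (hS : IsProximitySpecker A prec) (J : BoolEnd (idemRel prec)) :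
    Maximal (fun I : Ideal S => I ≠ ⊤ ∧ IsRoundIdeal A prec I) (idealOfIdem J.1) := by
  refine ⟨hS.isRound_idealOfIdem J.2.prop, fun I hI hle s hs => ?_⟩
  have h1 : J.1 ≤ idemOfIdeal A I := fun e he =>
    ⟨1, one_pos, hle ((hS.fAlgebra.smul_mem_idealOfIdem_iff one_ne_zero).2 he)⟩
  have h2 := le_antisymm h1 (J.2.le_of_ge (hS.isRound_idemOfIdeal hI) h1)
  rw [h2]
  exact hS.le_idealOfIdem_idemOfIdeal hI.2.1 hs

theorem idealOfIdem_idemOfIdeal (hS : IsProximitySpecker A prec) (I : AlgEnd A prec) :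
    idealOfIdem (idemOfIdeal A I.1) = I.1 :=
  have hle := hS.le_idealOfIdem_idemOfIdeal I.2.prop.2.1
  (le_antisymm hle (I.2.le_of_ge (hS.isRound_idealOfIdem (hS.isRound_idemOfIdeal I.2.prop))
    hle)).symm

theorem maximal_idemOfIdeal (hS : IsProximitySpecker A prec) (I : AlgEnd A prec) :
    Maximal (fun J : Order.Ideal (Idem S) => J ≠ ⊤ ∧ IsRoundBoolIdeal (idemRel prec) J)
      (idemOfIdeal A I.1) := by
  refine ⟨hS.isRound_idemOfIdeal I.2.prop, fun J hJ hle => ?_⟩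
  have h1 := idealOfIdem_mono hle
  rw [hS.idealOfIdem_idemOfIdeal] at h1
  have h2 := le_antisymm h1 (I.2.le_of_ge (hS.isRound_idealOfIdem hJ) h1)
  rw [h2, hS.idemOfIdeal_idealOfIdem]

/-- Ends of a proximity Specker algebra correspond to ends of its idempotents. -/
def algEndEquiv (hS : IsProximitySpecker A prec) : AlgEnd A prec ≃ BoolEnd (idemRel prec) where
  toFun I := ⟨idemOfIdeal A I.1, hS.maximal_idemOfIdeal I⟩
  invFun J := ⟨idealOfIdem J.1, hS.maximal_idealOfIdem J⟩
  left_inv I := Subtype.ext (hS.idealOfIdem_idemOfIdeal I)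
  right_inv J := Subtype.ext (hS.idemOfIdeal_idealOfIdem J.1)

end IsProximitySpecker

/-- A bijection that matches the subbases of two generated topologies is a homeomorphism. -/
theorem nonempty_homeomorph_of_generateFrom {X : Type u} {Y : Type v} [tX : TopologicalSpace X]
    [tY : TopologicalSpace Y] {U : Set (Set X)} {V : Set (Set Y)}
    (hX : tX = TopologicalSpace.generateFrom U) (hY : tY = TopologicalSpace.generateFrom V)
    (f : X ≃ Y) (hU : ∀ u ∈ U, f.symm ⁻¹' u ∈ V) (hV : ∀ v ∈ V, f ⁻¹' v ∈ U) :
    Nonempty (X ≃ₜ Y) := by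
  have h1 : Continuous f := by
    subst hY
    refine continuous_generateFrom_iff.2 fun v hv => ?_
    rw [hX]
    exact TopologicalSpace.isOpen_generateFrom_of_mem (hV v hv)
  have h2 : Continuous f.symm := by
    subst hX
    refine continuous_generateFrom_iff.2 fun u hu => ?_
    rw [hY]
    exact TopologicalSpace.isOpen_generateFrom_of_mem (hU u hu)
  exact ⟨{ f with continuous_toFun := h1, continuous_invFun := h2 }⟩

theorem IsProximitySpecker.nonempty_algEnd_homeomorph {prec : S → S → Prop} [IsDomain A]
    [IsOrderedRing A] (hS : IsProximitySpecker A prec) :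
    Nonempty (AlgEnd A prec ≃ₜ BoolEnd (idemRel prec)) := by
  refine nonempty_homeomorph_of_generateFrom rfl rfl hS.algEndEquiv ?_ ?_
  · rintro _ ⟨s, rfl⟩
    obtain ⟨e, he⟩ := hS.fAlgebra.exists_isSupport hS.specker s
    refine ⟨e, ?_⟩
    ext J
    exact (he.mem_idealOfIdem_iff hS.fAlgebra).symm
  · rintro _ ⟨e, rfl⟩
    refine ⟨e.1, ?_⟩
    ext I
    change e.1 ∈ I.1 ↔ e ∈ idemOfIdeal A I.1
    conv_lhs => rw [← hS.idealOfIdem_idemOfIdeal I, ← one_smul A e.1]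
    exact hS.fAlgebra.smul_mem_idealOfIdem_iff one_ne_zero

end

section

/-! ### Residues at an end -/

variable {A : Type u} [CommRing A] [LinearOrder A] {S : Type v} [CommRing S] [Algebra A S]
  [Lattice S]

/-- The element `c` is the lower limit of `s` at `J`: it bounds `s` from below off an element of
`J`, and from above on an idempotent outside `J`. -/
structure IsResidue (J : Order.Ideal (Idem S)) (s : S) (c : A) : Prop where
  lower : ∃ e ∈ J, c • (eᶜ).1 ≤ (eᶜ).1 * s
  upper : ∃ f ∉ J, f.1 * s ≤ c • f.1

theorem IsPoint.map_compl {S : Type v} [CommRing S] {R : Type w} [CommRing R] (π : S →+* R)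
    (e : Idem S) : π (eᶜ).1 = 1 - π e.1 := by
  rw [Idem.val_compl, map_sub, map_one]

namespace IsTorsionFreeFAlgebra

theorem smul_sup_le_mul (hS : IsTorsionFreeFAlgebra A S) {u v : Idem S} {c : A} {s : S}
    (hu : c • u.1 ≤ u.1 * s) (hv : c • v.1 ≤ v.1 * s) : c • (u ⊔ v).1 ≤ (u ⊔ v).1 * s :=
  hS.le_of_points fun R _ _ _ π hπ => by
    have h1 := hπ.mono hu
    have h2 := hπ.mono hv
    rw [Idem.val_sup]
    simp only [IsPoint.map_smul, map_mul, map_add, map_sub] at *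
    rcases IsPoint.map_idem π u with h | h
    · simpa [h] using h2
    · rcases IsPoint.map_idem π v with h' | h' <;> simpa [h, h'] using h1

theorem smul_le_mul_inf (hS : IsTorsionFreeFAlgebra A S) {u : Idem S} {c : A} {s t : S}
    (hs : c • u.1 ≤ u.1 * s) (ht : c • u.1 ≤ u.1 * t) : c • u.1 ≤ u.1 * (s ⊓ t) :=
  hS.le_of_points fun R _ _ _ π hπ => by
    have h1 := hπ.mono hs
    have h2 := hπ.mono ht
    rw [map_mul] at h1 h2 ⊢
    rw [hπ.map_inf]
    rcases IsPoint.map_idem π u with h | h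
    · simpa [h] using h1
    · rw [h, one_mul] at h1 h2 ⊢
      exact le_inf h1 h2

variable [IsOrderedRing A]

theorem smul_idem_le_mul_of_le (hS : IsTorsionFreeFAlgebra A S) {u v : Idem S} (huv : u ≤ v)
    {c d : A} (hcd : c ≤ d) {s t : S} (hst : s ≤ t) (h : d • v.1 ≤ v.1 * s) :
    c • u.1 ≤ u.1 * t :=
  hS.le_of_points fun R _ _ _ π hπ => by
    have h1 := hπ.mono (hS.idem_le_iff.1 huv)
    have h2 := hπ.algebraMap_mono hcd
    have h3 := hπ.mono hst
    have h4 := hπ.mono h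
    rw [IsPoint.map_smul, map_mul] at *
    rcases IsPoint.map_idem π u with hu | hu
    · simp [hu]
    · rcases IsPoint.map_idem π v with hv | hv
      · rw [hu, hv] at h1
        -- The factor may be the zero ring: `u ≤ v` with values 1 and 0 means `1 ≤ 0`, which
        -- collapses it.
        have : ∀ x : R, x = 0 := fun x => by
          rw [← mul_one x, le_antisymm h1 zero_le_one, mul_zero]
        rw [this (_ * _), this (_ * _)]
      · rw [hv, mul_one, one_mul] at h4
        rw [hu, mul_one, one_mul]
        exact h2.trans (h4.trans h3)

/-- If `d < c`, then on `f ⊓ eᶜ` one has `c ≤ s ≤ t ≤ d`, so `f ⊓ eᶜ` vanishes and `f ≤ e` lies in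
`J`, a contradiction. With `s = t` this is uniqueness of the lower limit. -/
theorem isResidue_mono (hS : IsTorsionFreeFAlgebra A S) {J : Order.Ideal (Idem S)} {s t : S}
    {c d : A} (hst : s ≤ t) (hs : IsResidue J s c) (ht : IsResidue J t d) : c ≤ d := by
  by_contra! hdc
  obtain ⟨e, he, hce⟩ := hs.lower
  obtain ⟨f, hf, hfd⟩ := ht.upper
  refine hf (J.lower ?_ he)
  have h0 : (c - d) • (f ⊓ eᶜ).1 ≤ 0 := hS.le_of_points fun R _ _ _ π hπ => by
    have h1 := hπ.mono hce
    have h2 := hπ.mono hfd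
    have h3 := hπ.mono hst
    rw [Idem.val_inf]
    simp only [IsPoint.map_smul, map_mul, IsPoint.map_compl, map_sub, map_zero] at *
    rcases IsPoint.map_idem π f with h | h <;> rcases IsPoint.map_idem π e with h' | h' <;>
      rw [h] at h2 <;> rw [h'] at h1 <;> simp only [h, h'] <;> simp at *
    exact h1.trans (h3.trans h2)
  have := hS.eq_bot_of_smul_idem_nonpos (sub_pos.2 hdc) h0
  rwa [← disjoint_iff, disjoint_compl_right_iff] at this

/-- The lower limit is the least value of `s` on the pieces outside `J`. Pieces in `J` are absorbed
into the exceptional idempotent; when two others are joined, the smaller scalar is kept with its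
upper witness. -/
theorem exists_isResidue (hS : IsTorsionFreeFAlgebra A S) (hsp : IsSpecker A S)
    {J : Order.Ideal (Idem S)} (hJ : ⊤ ∉ J) (s : S) : ∃ c : A, IsResidue J s c := by
  have key := hsp.induction s (Q := fun x => x ∈ J ∨ ∃ c : A,
    (∃ e ∈ J, c • (x ⊓ eᶜ).1 ≤ (x ⊓ eᶜ).1 * s) ∧ ∃ f ∉ J, f.1 * s ≤ c • f.1) ?_ ?_
  · obtain ⟨c, ⟨e, he, h⟩, h'⟩ := key.resolve_left hJ
    exact ⟨c, ⟨e, he, by simpa only [top_inf_eq] using h⟩, h'⟩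
  · intro x a hx
    by_cases hxJ : x ∈ J
    · exact Or.inl hxJ
    · exact Or.inr ⟨a, ⟨⊥, J.bot_mem, by simpa only [compl_bot, inf_top_eq] using hx.ge⟩,
        x, hxJ, hx.le⟩
  · have one_side : ∀ x y : Idem S, ∀ c d : A, ∀ e ∈ J, ∀ k ∈ J,
        c • (x ⊓ eᶜ).1 ≤ (x ⊓ eᶜ).1 * s → d • (y ⊓ kᶜ).1 ≤ (y ⊓ kᶜ).1 * s → c ≤ d →
        ∃ l ∈ J, c • ((x ⊔ y) ⊓ lᶜ).1 ≤ ((x ⊔ y) ⊓ lᶜ).1 * s := by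
      intro x y c d e he k hk hc hd hcd
      refine ⟨e ⊔ k, Order.Ideal.sup_mem he hk, ?_⟩
      rw [inf_sup_right]
      refine hS.smul_sup_le_mul (hS.smul_idem_le_mul_of_le ?_ le_rfl le_rfl hc)
        (hS.smul_idem_le_mul_of_le ?_ hcd le_rfl hd)
      · exact inf_le_inf_left _ (compl_le_compl le_sup_left)
      · exact inf_le_inf_left _ (compl_le_compl le_sup_right)
    have absorb : ∀ x ∈ J, ∀ y : Idem S, ∀ c : A, ∀ e ∈ J, c • (y ⊓ eᶜ).1 ≤ (y ⊓ eᶜ).1 * s →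
        ∃ l ∈ J, c • ((x ⊔ y) ⊓ lᶜ).1 ≤ ((x ⊔ y) ⊓ lᶜ).1 * s := by
      intro x hx y c e he hc
      refine one_side x y c c x hx e he ?_ hc le_rfl
      rw [inf_compl_self, Idem.val_bot, smul_zero, zero_mul]
    rintro x y (hx | ⟨c, ⟨e, he, hc⟩, hf⟩) (hy | ⟨d, ⟨k, hk, hd⟩, hg⟩)
    · exact Or.inl (Order.Ideal.sup_mem hx hy)
    · exact Or.inr ⟨d, absorb x hx y d k hk hd, hg⟩
    · refine Or.inr ⟨c, ?_, hf⟩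
      rw [sup_comm]
      exact absorb y hy x c e he hc
    · right
      rcases le_total c d with hcd | hcd
      · exact ⟨c, one_side x y c d e he k hk hc hd hcd, hf⟩
      · refine ⟨d, ?_, hg⟩
        rw [sup_comm]
        exact one_side y x d c k hk e he hd hc hcd

end IsTorsionFreeFAlgebra

namespace IsProximity

variable {prec : S → S → Prop}

theorem const_prec [IsOrderedRing A] (hP : IsProximity A prec) (a : A) : prec (a • 1) (a • 1) := by
  rcases lt_trichotomy a 0 with ha | ha | ha
  · have := hP.neg _ _ (hP.smul (-a) 1 1 (neg_pos.2 ha) hP.one_prec_one)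
    simpa using this
  · rw [ha, zero_smul]
    exact hP.zero_prec_zero
  · exact hP.smul a 1 1 ha hP.one_prec_one

/-- The axioms speak only of meets on the right; negation turns that into joins on the left. -/
theorem sup_zero_prec_sup_zero (hP : IsProximity A prec) (hF : IsTorsionFreeFAlgebra A S)
    {s t : S} (h : prec s t) : prec (s ⊔ 0) (t ⊔ 0) := by
  have h1 := hP.neg _ _ (hP.mono _ _ _ _ le_rfl h (le_sup_left (b := 0)))
  have h2 := hP.neg _ _ (hP.mono _ _ _ _ le_rfl hP.zero_prec_zero (le_sup_right (a := t)))
  have h3 := hP.neg _ _ (hP.prec_inf _ _ _ h1 h2)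
  rw [neg_neg] at h3
  refine hP.mono _ _ _ _ (hF.le_of_points fun R _ _ _ π hπ => ?_) h3 le_rfl
  rw [hπ.map_sup, map_neg, hπ.map_inf, map_neg, map_neg, neg_inf, neg_neg, neg_neg]

end IsProximity

/-! ### The lower limit at an end is a proximity morphism. -/

namespace BoolEnd

variable {prec : S → S → Prop} [IsOrderedRing A]

theorem exists_isResidue (hS : IsProximitySpecker A prec) (J : BoolEnd (idemRel prec)) (s : S) :
    ∃ c : A, IsResidue J.1 s c :=
  hS.fAlgebra.exists_isResidue hS.specker J.top_notMem s

/-- The value at an end of an element of a proximity Specker algebra. -/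
noncomputable def residue (hS : IsProximitySpecker A prec) (J : BoolEnd (idemRel prec)) (s : S) :
    A :=
  (J.exists_isResidue hS s).choose

theorem isResidue_residue (hS : IsProximitySpecker A prec) (J : BoolEnd (idemRel prec)) (s : S) :
    IsResidue J.1 s (J.residue hS s) :=
  (J.exists_isResidue hS s).choose_spec

theorem residue_eq (hS : IsProximitySpecker A prec) (J : BoolEnd (idemRel prec)) {s : S} {c : A}
    (h : IsResidue J.1 s c) : J.residue hS s = c :=
  le_antisymm (hS.fAlgebra.isResidue_mono le_rfl (J.isResidue_residue hS s) h)
    (hS.fAlgebra.isResidue_mono le_rfl h (J.isResidue_residue hS s))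

theorem residue_mono (hS : IsProximitySpecker A prec) (J : BoolEnd (idemRel prec)) {s t : S}
    (hst : s ≤ t) : J.residue hS s ≤ J.residue hS t :=
  hS.fAlgebra.isResidue_mono hst (J.isResidue_residue hS s) (J.isResidue_residue hS t)

theorem residue_zero (hS : IsProximitySpecker A prec) (J : BoolEnd (idemRel prec)) :
    J.residue hS 0 = 0 :=
  J.residue_eq hS ⟨⟨⊥, J.1.bot_mem, by rw [zero_smul, mul_zero]⟩,
    ⊤, J.top_notMem, by rw [zero_smul, mul_zero]⟩

theorem residue_inf (hS : IsProximitySpecker A prec) (J : BoolEnd (idemRel prec)) (s t : S) :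
    J.residue hS (s ⊓ t) = J.residue hS s ⊓ J.residue hS t := by
  have hF := hS.fAlgebra
  obtain ⟨⟨e, he, hce⟩, f, hf, hcf⟩ := J.isResidue_residue hS s
  obtain ⟨⟨k, hk, hdk⟩, g, hg, hdg⟩ := J.isResidue_residue hS t
  refine J.residue_eq hS ⟨⟨e ⊔ k, Order.Ideal.sup_mem he hk, ?_⟩, ?_⟩
  · have h1 := hF.smul_idem_le_mul_of_le (compl_le_compl (le_sup_left (a := e) (b := k)))
      (inf_le_left (b := J.residue hS t)) le_rfl hce
    have h2 := hF.smul_idem_le_mul_of_le (compl_le_compl (le_sup_right (a := e) (b := k)))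
      (inf_le_right (a := J.residue hS s)) le_rfl hdk
    exact hF.smul_le_mul_inf h1 h2
  · have hle : ∀ (l : Idem S) (x y : S), x ≤ y → l.1 * x ≤ l.1 * y := fun l x y hxy =>
      hF.le_of_points fun R _ _ _ π hπ => by
        rw [map_mul, map_mul]
        rcases IsPoint.map_idem π l with h | h <;> simp [h, hπ.mono hxy]
    rcases le_total (J.residue hS s) (J.residue hS t) with h | h
    · rw [inf_eq_left.2 h]
      exact ⟨f, hf, (hle f _ _ inf_le_left).trans hcf⟩
    · rw [inf_eq_right.2 h]
      exact ⟨g, hg, (hle g _ _ inf_le_right).trans hdg⟩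

theorem residue_add_const (hS : IsProximitySpecker A prec) (J : BoolEnd (idemRel prec)) (s : S)
    (a : A) : J.residue hS (s + algebraMap A S a) = J.residue hS s + a := by
  have hF := hS.fAlgebra
  obtain ⟨⟨e, he, hce⟩, f, hf, hcf⟩ := J.isResidue_residue hS s
  refine J.residue_eq hS ⟨⟨e, he, ?_⟩, f, hf, ?_⟩ <;>
    refine hF.le_of_points fun R _ _ _ π hπ => ?_
  · have h1 := hπ.mono hce
    simp only [IsPoint.map_smul, map_mul, map_add] at *
    rw [add_mul, mul_add, mul_comm _ (π (algebraMap A S a))]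
    exact add_le_add_left h1 _
  · have h1 := hπ.mono hcf
    simp only [IsPoint.map_smul, map_mul, map_add] at *
    rw [add_mul, mul_add, mul_comm _ (π (algebraMap A S a))]
    exact add_le_add_left h1 _

theorem residue_smul (hS : IsProximitySpecker A prec) (J : BoolEnd (idemRel prec)) {a : A}
    (ha : 0 < a) (s : S) : J.residue hS (a • s) = a * J.residue hS s := by
  have hF := hS.fAlgebra
  obtain ⟨⟨e, he, hce⟩, f, hf, hcf⟩ := J.isResidue_residue hS s
  refine J.residue_eq hS ⟨⟨e, he, ?_⟩, f, hf, ?_⟩ <;>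
    refine hF.le_of_points fun R _ _ _ π hπ => ?_
  · have h1 := mul_le_mul_of_nonneg_left (hπ.mono hce) (hπ.map_nonneg a ha.le)
    simp only [IsPoint.map_smul, map_mul] at *
    rwa [mul_assoc, mul_left_comm (π (eᶜ).1)]
  · have h1 := mul_le_mul_of_nonneg_left (hπ.mono hcf) (hπ.map_nonneg a ha.le)
    simp only [IsPoint.map_smul, map_mul] at *
    rwa [mul_assoc, mul_left_comm (π f.1)]

theorem residue_sup_const (hS : IsProximitySpecker A prec) (J : BoolEnd (idemRel prec)) (s : S)
    (a : A) : J.residue hS (s ⊔ algebraMap A S a) = J.residue hS s ⊔ a := by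
  have hF := hS.fAlgebra
  obtain ⟨⟨e, he, hce⟩, f, hf, hcf⟩ := J.isResidue_residue hS s
  refine J.residue_eq hS ⟨⟨e, he, ?_⟩, f, hf, ?_⟩
  · rcases le_total (J.residue hS s) a with h | h
    · rw [sup_eq_right.2 h]
      refine hF.le_of_points fun R _ _ _ π hπ => ?_
      rw [IsPoint.map_smul, map_mul, hπ.map_sup]
      rcases IsPoint.map_idem π eᶜ with h | h <;> simp [h]
    · rw [sup_eq_left.2 h]
      exact hF.smul_idem_le_mul_of_le le_rfl le_rfl le_sup_left hce
  · refine hF.le_of_points fun R _ _ _ π hπ => ?_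
    have h1 := hπ.mono hcf
    have h2 := hπ.algebraMap_mono (le_sup_left (a := J.residue hS s) (b := a))
    have h3 := hπ.algebraMap_mono (le_sup_right (a := J.residue hS s) (b := a))
    rw [IsPoint.map_smul, map_mul] at *
    rw [hπ.map_sup]
    rcases IsPoint.map_idem π f with h | h
    · simp [h]
    · rw [h, one_mul, mul_one] at h1 ⊢
      exact sup_le (h1.trans h2) h3

variable [IsDomain A]

/-- Outside `J` there are `f` on which `t ≤ c` and `g` on which `s ≥ -p`. If `c < -p`, then `(s -
c)⁺ ≺ (t - c)⁺` separates them: the left side dominates `(-p - c) • g` and the right is at most a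
multiple of `fᶜ`. So `g ≺ fᶜ`, and the end contains `g` or `f`. -/
theorem neg_residue_neg_le (hS : IsProximitySpecker A prec) (J : BoolEnd (idemRel prec))
    {s t : S} (hst : prec s t) : -J.residue hS (-s) ≤ J.residue hS t := by
  have hF := hS.fAlgebra
  have hP := hS.proximity
  obtain ⟨-, f, hf, hcf⟩ := J.isResidue_residue hS t
  obtain ⟨-, g, hg, hdg⟩ := J.isResidue_residue hS (-s)
  set c := J.residue hS t
  set p := J.residue hS (-s)
  by_contra! hcp
  have h1 := hP.sup_zero_prec_sup_zero hF (hP.add _ _ _ _ hst (hP.const_prec (-c)))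
  obtain ⟨b, hb, hbt⟩ := hF.exists_abs_le hS.specker ((t + -c • 1) ⊔ 0)
  have hgf : idemRel prec g fᶜ := by
    refine hS.prec_of_smul_le (sub_pos.2 hcp) ?_ h1 (b := b) ?_
    · refine hF.le_of_points fun R _ _ _ π hπ => ?_
      have h2 := hπ.mono hdg
      simp only [IsPoint.map_smul, map_mul, hπ.map_sup, map_add, map_sub, map_neg, map_one,
        map_zero] at *
      rcases IsPoint.map_idem π g with h | h
      · simp [h]
      · rw [h, mul_one, one_mul] at h2
        rw [h, mul_one, mul_one]
        refine le_sup_of_le_left ?_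
        rw [sub_eq_add_neg]
        exact add_le_add_left (neg_le.1 h2) _
    · refine hF.le_of_points fun R _ _ _ π hπ => ?_
      have h2 := hπ.mono hbt
      have h3 := hπ.mono hcf
      rw [hπ.map_abs] at h2
      simp only [IsPoint.map_smul, map_mul, hπ.map_sup, map_add, IsPoint.map_compl, map_neg,
        map_one, map_zero] at *
      rcases IsPoint.map_idem π f with h | h
      · rw [h, sub_zero]
        exact (le_abs_self _).trans h2
      · rw [h, mul_one, one_mul] at h3
        rw [h, sub_self, mul_zero, mul_one]
        refine sup_le ?_ le_rfl
        rw [← sub_eq_add_neg]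
        exact sub_nonpos.2 h3
  rcases J.mem_or_compl_mem hS.isBooleanProximity hgf with h | h
  · exact hg h
  · exact hf (by rwa [compl_compl] at h)

theorem compl_notMem {B : Type u} [BooleanAlgebra B] {prec : B → B → Prop} (J : BoolEnd prec)
    {a : B} (ha : a ∈ J.1) : aᶜ ∉ J.1 := fun h => J.notMem_of_compl_mem h ha

theorem exists_prec_residue_eq (hS : IsProximitySpecker A prec) (J : BoolEnd (idemRel prec))
    (s : S) : ∃ t, prec t s ∧ J.residue hS t = J.residue hS s := by
  have hF := hS.fAlgebra
  have hP := hS.proximity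
  obtain ⟨⟨e, he, hce⟩, -⟩ := J.isResidue_residue hS s
  set c := J.residue hS s
  obtain ⟨k, hk, hek⟩ := J.exists_prec hS.isBooleanProximity he
  obtain ⟨b, hb, hbs⟩ := hF.exists_abs_le hS.specker s
  have hM : 0 < c + (b + |c|) := by have := neg_abs_le c; linarith
  have hbM : b ≤ b + |c| := le_add_of_nonneg_right (_root_.abs_nonneg c)
  set M := b + |c|
  -- The witness equals `c` off `k` and `-M` on `k`, where `e ≺ k ∈ J` and `-M` is below all values
  -- of `s`. It is `≺` the same expression with `e` for `k`, which is at most `s`; thus the supremum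
  -- is attained.
  refine ⟨(c + M) • (kᶜ).1 + (-M) • 1, ?_,
    J.residue_eq hS ⟨⟨k, hk, ?_⟩, kᶜ, J.compl_notMem hk, ?_⟩⟩
  · refine hP.mono _ _ _ _ le_rfl (hP.add _ _ _ _
      (hP.smul _ _ _ hM (hS.isBooleanProximity.compl _ _ hek)) (hP.const_prec (-M))) ?_
    refine hF.le_of_points fun R _ _ _ π hπ => ?_
    have h1 := hπ.mono hce
    have h2 := hπ.mono hbs
    have h3 := hπ.algebraMap_mono hbM
    rw [hπ.map_abs] at h2
    simp only [IsPoint.map_smul, map_mul, map_add, map_neg, map_one, mul_one,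
      IsPoint.map_compl] at *
    rcases IsPoint.map_idem π e with h | h
    · simpa [h] using h1
    · rw [h, sub_self, mul_zero, zero_add]
      exact neg_le_of_abs_le (h2.trans h3)
  all_goals
    refine le_of_eq (hF.eq_of_points fun R _ _ _ π hπ => ?_)
    simp only [IsPoint.map_smul, map_mul, map_add, map_neg, map_one, mul_one]
    rcases IsPoint.map_idem π kᶜ with h | h <;> simp [h]

theorem isProximityMorphism_residue (hS : IsProximitySpecker A prec)
    (J : BoolEnd (idemRel prec)) :
    IsProximityMorphism A prec (fun a b : A => a ≤ b) (J.residue hS) where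
  map_zero := J.residue_zero hS
  map_inf := J.residue_inf hS
  map_prec _ _ := J.neg_residue_neg_le hS
  isLUB s := by
    refine IsGreatest.isLUB ⟨J.exists_prec_residue_eq hS s, ?_⟩
    rintro _ ⟨t, hts, rfl⟩
    exact J.residue_mono hS (hS.proximity.le_of_prec _ _ hts)
  map_add_const := J.residue_add_const hS
  map_smul _ s ha := J.residue_smul hS ha s
  map_sup_const := J.residue_sup_const hS

end BoolEnd

end

section

/-! ### Proximity morphisms to the scalars -/

variable {A : Type u} [CommRing A] [LinearOrder A] {S : Type v} [CommRing S] [Algebra A S]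
  [Lattice S] {prec : S → S → Prop}

namespace ProxHom

theorem mono (α : ProxHom A prec) {s t : S} (h : s ≤ t) : α.1 s ≤ α.1 t := by
  have := α.2.map_inf s t
  rw [inf_eq_left.2 h] at this
  exact inf_eq_left.1 this.symm

theorem map_const (α : ProxHom A prec) (a : A) : α.1 (algebraMap A S a) = a := by
  have := α.2.map_add_const 0 a
  rwa [zero_add, α.2.map_zero, zero_add] at this

theorem map_one (α : ProxHom A prec) : α.1 1 = 1 := by
  simpa using α.map_const 1

theorem map_compl (α : ProxHom A prec) (e : Idem S) : α.1 (eᶜ).1 = α.1 (-e.1) + 1 := by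
  have := α.2.map_add_const (-e.1) 1
  rwa [_root_.map_one, _root_.map_one, neg_add_eq_sub] at this

variable [IsDomain A] [IsOrderedRing A]

/-- For `a = α(e)` between 0 and 1, truncation is scaling: `e ⊓ a = a • e`. If `a > 0`, applying `α`
gives `a = a * a`, so `a = 1`. -/
theorem map_idem (hS : IsProximitySpecker A prec) (α : ProxHom A prec) (e : Idem S) :
    α.1 e.1 = 0 ∨ α.1 e.1 = 1 := by
  have hF := hS.fAlgebra
  have h0 : 0 ≤ α.1 e.1 := by
    simpa [α.2.map_zero] using α.mono (hF.idem_nonneg e)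
  have h1 : α.1 e.1 ≤ 1 := by
    rw [← α.map_one]
    exact α.mono (hF.idem_le_iff.1 (le_top (a := e)))
  rcases h0.eq_or_lt with h | h
  · exact Or.inl h.symm
  set a := α.1 e.1 with ha
  have key : e.1 ⊓ algebraMap A S a = a • e.1 := hF.eq_of_points fun R _ _ _ π hπ => by
    have h2 := hπ.map_nonneg a h0
    have h3 := hπ.algebraMap_mono h1
    rw [_root_.map_one, _root_.map_one] at h3
    rw [hπ.map_inf, IsPoint.map_smul]
    rcases IsPoint.map_idem π e with h | h <;> simp [h, h2, h3]
  have h4 := α.2.map_inf e.1 (algebraMap A S a)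
  rw [key, α.2.map_smul a _ h, α.map_const, ← ha, inf_idem, smul_eq_mul] at h4
  exact Or.inr (mul_left_cancel₀ h.ne' (by rw [h4, mul_one]))

/-- The idempotents on whose complement a proximity morphism takes the value `1`. -/
def kerIdem (hS : IsProximitySpecker A prec) (α : ProxHom A prec) : Order.Ideal (Idem S) :=
  orderIdealOf (fun e => α.1 (eᶜ).1 = 1)
    (by rw [compl_bot, Idem.val_top, α.map_one])
    (by
      intro e k he hk
      refine (α.map_idem hS _).resolve_left fun h0 => ?_
      have h1 : (eᶜ).1 ⊓ (kᶜ).1 ≤ ((e ⊔ k)ᶜ).1 := hS.fAlgebra.le_of_points fun R _ _ _ π hπ => by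
        rw [compl_sup, Idem.val_inf, map_mul, hπ.map_inf]
        rcases IsPoint.map_idem π eᶜ with h | h <;> rcases IsPoint.map_idem π kᶜ with h' | h' <;>
          simp [h, h']
      have h2 := α.mono h1
      rw [α.2.map_inf, he, hk, h0, inf_idem] at h2
      exact h2.not_gt one_pos)
    (by
      intro e k hek hk
      refine (α.map_idem hS _).resolve_left fun h0 => ?_
      have h2 := α.mono (hS.fAlgebra.idem_le_iff.1 (compl_le_compl hek))
      rw [hk, h0] at h2
      exact h2.not_gt one_pos)

theorem mem_kerIdem {hS : IsProximitySpecker A prec} {α : ProxHom A prec} {e : Idem S} :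
    e ∈ α.kerIdem hS ↔ α.1 (eᶜ).1 = 1 := Iff.rfl

theorem maximal_kerIdem (hS : IsProximitySpecker A prec) (α : ProxHom A prec) :
    Maximal (fun J : Order.Ideal (Idem S) => J ≠ ⊤ ∧ IsRoundBoolIdeal (idemRel prec) J)
      (α.kerIdem hS) := by
  have hF := hS.fAlgebra
  have hP := hS.proximity
  rw [hS.isBooleanProximity.maximal_iff]
  refine ⟨⟨?_, ?_⟩, ?_⟩
  · rw [← Order.Ideal.top_notMem_iff_ne_top, mem_kerIdem, compl_top, Idem.val_bot, α.2.map_zero]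
    exact zero_ne_one
  · rw [hS.isBooleanProximity.isRound_iff]
    intro e he
    rw [mem_kerIdem] at he
    -- Roundness comes from the supremum axiom: since `α(eᶜ) = 1`, some `t ≺ eᶜ` has positive value,
    -- and the complement of the support of `t⁺` is the required element.
    have hex : ∃ t, prec t (eᶜ).1 ∧ 0 < α.1 t := by
      by_contra! hcon
      have : α.1 (eᶜ).1 ≤ 0 := (α.2.isLUB (eᶜ).1).2 (by
        rintro _ ⟨t, ht, rfl⟩
        exact hcon t ht)
      rw [he] at this
      exact this.not_gt one_pos
    obtain ⟨t, ht, hpos⟩ := hex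
    have ht' : prec (t ⊔ 0) (eᶜ).1 :=
      hP.mono _ _ _ _ le_rfl (hP.sup_zero_prec_sup_zero hF ht)
        (sup_le le_rfl (hF.idem_nonneg _))
    obtain ⟨k, a, b, ha, hb, hak, hkb⟩ := hF.exists_support hS.specker (le_sup_right (a := t))
    have hk : idemRel prec k eᶜ := hS.prec_of_smul_le ha hak ht' (one_smul A (eᶜ).1).ge
    refine ⟨kᶜ, ?_, by simpa using hS.isBooleanProximity.compl _ _ hk⟩
    rw [mem_kerIdem, compl_compl]
    refine (α.map_idem hS k).resolve_left fun h0 => ?_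
    have h1 := α.mono (le_sup_left.trans hkb)
    rw [α.2.map_smul b _ hb, h0, smul_zero] at h1
    exact h1.not_gt hpos
  · intro e k hek
    rw [mem_kerIdem, mem_kerIdem, compl_compl]
    rcases α.map_idem hS eᶜ with h | h
    · right
      rw [α.map_compl] at h
      have h1 := α.2.map_prec _ _ hek
      rw [← eq_neg_of_add_eq_zero_right h] at h1
      refine (α.map_idem hS k).resolve_left fun h0 => ?_
      rw [h0] at h1
      exact h1.not_gt one_pos
    · exact Or.inl h

/-- A proximity morphism takes at each element its residue at the associated end. -/
theorem isResidue_kerIdem (hS : IsProximitySpecker A prec) (α : ProxHom A prec) (s : S) :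
    IsResidue (α.kerIdem hS) s (α.1 s) := by
  have hF := hS.fAlgebra
  -- Shifting by `c` makes `α(x) = 0`. The support `e` of `x⁻` is the exceptional element of the
  -- ideal, and `s ≤ c` holds off the support `f` of `x⁺`.
  set c := α.1 s with hc
  set x := s + algebraMap A S (-c) with hx
  have hx0 : α.1 x = 0 := by
    rw [α.2.map_add_const, ← hc, Algebra.algebraMap_self_apply, add_neg_cancel]
  have hneg : 0 ≤ -(x ⊓ 0) := hF.le_of_points fun R _ _ _ π hπ => by
    rw [map_neg, hπ.map_inf, map_zero]
    exact neg_nonneg.2 inf_le_right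
  obtain ⟨e, a, b, ha, hb, hae, hbe⟩ := hF.exists_support hS.specker hneg
  obtain ⟨f, a', b', ha', hb', hae', hbe'⟩ :=
    hF.exists_support hS.specker (le_sup_right (a := x) (b := 0))
  refine ⟨⟨e, ?_, ?_⟩, fᶜ, ?_, ?_⟩
  · rw [mem_kerIdem]
    refine (α.map_idem hS _).resolve_left fun h0 => ?_
    -- If `α(eᶜ) = 0` then `α(-e) = -1`, so this inequality would give `0 ≤ -a`.
    have h1 : x ⊓ 0 ≤ a • (-e.1) := hF.le_of_points fun R _ _ _ π hπ => by
      have := hπ.mono hae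
      rw [smul_neg, map_neg]
      rw [map_neg] at this
      exact le_neg.1 this
    have h2 := α.mono h1
    rw [α.2.map_inf, hx0, α.2.map_zero, inf_idem, α.2.map_smul a _ ha, smul_eq_mul] at h2
    rw [α.map_compl] at h0
    rw [eq_neg_of_add_eq_zero_left h0, mul_neg, mul_one] at h2
    exact (neg_nonneg.1 h2).not_gt ha
  · refine hF.le_of_points fun R _ _ _ π hπ => ?_
    have h1 := hπ.mono hbe
    simp only [hx, IsPoint.map_smul, map_mul, IsPoint.map_compl, map_neg, hπ.map_inf, map_add,
      map_zero] at *
    rcases IsPoint.map_idem π e with h | h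
    · rw [h, mul_zero] at h1
      have h2 := (neg_nonpos.1 h1).trans inf_le_left
      rw [h, sub_zero, mul_one, one_mul]
      rwa [← sub_eq_add_neg, sub_nonneg] at h2
    · simp [h]
  · rw [mem_kerIdem, compl_compl]
    intro h
    have h1 := α.mono hae'
    have h2 := α.2.map_sup_const x 0
    rw [map_zero, map_zero, hx0, sup_idem] at h2
    rw [h2, α.2.map_smul _ _ ha', h, smul_eq_mul, mul_one] at h1
    exact h1.not_gt ha'
  · refine hF.le_of_points fun R _ _ _ π hπ => ?_
    have h1 := hπ.mono hbe'
    simp only [hx, IsPoint.map_smul, map_mul, IsPoint.map_compl, map_neg, hπ.map_sup, map_add,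
      map_zero] at *
    rcases IsPoint.map_idem π f with h | h
    · rw [h, mul_zero] at h1
      have h2 := le_sup_left.trans h1
      rw [h, sub_zero, mul_one, one_mul]
      rwa [← sub_eq_add_neg, sub_nonpos] at h2
    · simp [h]

end ProxHom

/-! ### Matching morphisms and their topology with ends. -/

variable [IsOrderedRing A]

theorem BoolEnd.residue_compl_eq_one_iff (hS : IsProximitySpecker A prec)
    (J : BoolEnd (idemRel prec)) (e : Idem S) : J.residue hS (eᶜ).1 = 1 ↔ e ∈ J.1 := by
  have hF := hS.fAlgebra
  constructor
  · intro h
    obtain ⟨⟨k, hk, hke⟩, -⟩ := J.isResidue_residue hS (eᶜ).1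
    rw [h, one_smul] at hke
    refine J.1.lower ?_ hk
    have : kᶜ ≤ kᶜ ⊓ eᶜ := hF.idem_le_iff.2 (by rwa [Idem.val_inf])
    exact compl_le_compl_iff_le.1 (this.trans inf_le_right)
  · intro h
    refine J.residue_eq hS ⟨⟨e, h, ?_⟩, eᶜ, J.compl_notMem h, ?_⟩ <;>
      rw [one_smul, Idem.mul_self]

variable [IsDomain A]

/-- This identifies the basic set of `s` among morphisms with that of its support among ends. A `t`
with lower limit 0 is `≤ 0` on some `f` outside `J`, so `|s| ≺ t` gives `e ≺ fᶜ` and the end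
contains `e`. Conversely, if `e ≺ k ∈ J`, then `b • k` is a suitable `t`. -/
theorem BoolEnd.exists_prec_residue_eq_zero_iff (hS : IsProximitySpecker A prec)
    (J : BoolEnd (idemRel prec)) {e : Idem S} {s : S} (he : IsSupport A e s) :
    (∃ t, prec |s| t ∧ J.residue hS t = 0) ↔ e ∈ J.1 := by
  have hF := hS.fAlgebra
  have hP := hS.proximity
  obtain ⟨a, b, ha, hb, hae, hbe⟩ := he
  constructor
  · rintro ⟨t, hst, ht⟩
    obtain ⟨-, f, hf, hft⟩ := J.isResidue_residue hS t
    rw [ht, zero_smul] at hft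
    obtain ⟨c, hc, htc⟩ := hF.exists_abs_le hS.specker t
    have hef : idemRel prec e fᶜ := by
      refine hS.prec_of_smul_le ha hae hst (b := c) ?_
      refine hF.le_of_points fun R _ _ _ π hπ => ?_
      have h1 := hπ.mono hft
      have h2 := hπ.mono htc
      rw [hπ.map_abs] at h2
      simp only [IsPoint.map_smul, map_mul, IsPoint.map_compl, map_one, map_zero] at *
      rcases IsPoint.map_idem π f with h | h
      · rw [h, sub_zero]
        exact (le_abs_self _).trans h2
      · simpa [h] using h1
    rcases J.mem_or_compl_mem hS.isBooleanProximity hef with h | h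
    · exact h
    · exact absurd (by rwa [compl_compl] at h) hf
  · intro h
    obtain ⟨k, hk, hek⟩ := J.exists_prec hS.isBooleanProximity h
    refine ⟨b • k.1, hP.mono _ _ _ _ hbe (hP.smul b _ _ hb hek) le_rfl, ?_⟩
    refine J.residue_eq hS ⟨⟨k, hk, ?_⟩, kᶜ, J.compl_notMem hk, ?_⟩ <;>
    · refine le_of_eq (hF.eq_of_points fun R _ _ _ π hπ => ?_)
      simp only [IsPoint.map_smul, map_mul, map_zero, zero_mul, IsPoint.map_compl]
      rcases IsPoint.map_idem π k with h | h <;> simp [h]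

/-- Proximity morphisms to the scalars correspond to ends of the idempotents. -/
noncomputable def IsProximitySpecker.proxHomEquiv (hS : IsProximitySpecker A prec) :
    ProxHom A prec ≃ BoolEnd (idemRel prec) where
  toFun α := ⟨α.kerIdem hS, α.maximal_kerIdem hS⟩
  invFun J := ⟨J.residue hS, J.isProximityMorphism_residue hS⟩
  left_inv α := Subtype.ext (funext fun s =>
    BoolEnd.residue_eq hS ⟨α.kerIdem hS, α.maximal_kerIdem hS⟩ (α.isResidue_kerIdem hS s))
  right_inv J := Subtype.ext (Order.Ideal.ext (Set.ext fun e =>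
    J.residue_compl_eq_one_iff hS e))

theorem IsProximitySpecker.nonempty_proxHom_homeomorph (hS : IsProximitySpecker A prec) :
    Nonempty (ProxHom A prec ≃ₜ BoolEnd (idemRel prec)) := by
  refine nonempty_homeomorph_of_generateFrom rfl rfl hS.proxHomEquiv ?_ ?_
  · rintro _ ⟨s, rfl⟩
    obtain ⟨e, he⟩ := hS.fAlgebra.exists_isSupport hS.specker s
    refine ⟨e, ?_⟩
    ext J
    exact (J.exists_prec_residue_eq_zero_iff hS he).symm
  · rintro _ ⟨e, rfl⟩
    refine ⟨e.1, ?_⟩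
    ext α
    have he : IsSupport A e e.1 := by
      refine ⟨1, 1, one_pos, one_pos, ?_, ?_⟩ <;>
        rw [hS.fAlgebra.abs_of_nonneg (hS.fAlgebra.idem_nonneg e), one_smul]
    obtain ⟨J, rfl⟩ := hS.proxHomEquiv.symm.surjective α
    have h1 := J.exists_prec_residue_eq_zero_iff hS he
    have h2 : hS.proxHomEquiv (hS.proxHomEquiv.symm J) = J := Equiv.apply_symm_apply _ _
    change (∃ t, prec |e.1| t ∧ J.residue hS t = 0) ↔
      e ∈ (hS.proxHomEquiv (hS.proxHomEquiv.symm J)).1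
    rw [h2]
    exact h1

end

theorem mainTheorem7 {A : Type u} [CommRing A] [IsDomain A] [LinearOrder A] [IsOrderedRing A]
    {S : Type v} [CommRing S] [Algebra A S] [Lattice S] (prec : S → S → Prop)
    (hS : IsProximitySpecker A prec) :
    IsBooleanProximity (idemRel prec) ∧
      CompactSpace (BoolEnd (idemRel prec)) ∧
      T2Space (BoolEnd (idemRel prec)) ∧
      Nonempty (AlgEnd A prec ≃ₜ BoolEnd (idemRel prec)) ∧
      Nonempty (ProxHom A prec ≃ₜ BoolEnd (idemRel prec)) :=
  ⟨hS.isBooleanProximity, BoolEnd.compactSpace hS.isBooleanProximity,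
    BoolEnd.t2Space hS.isBooleanProximity, hS.nonempty_algEnd_homeomorph,
    hS.nonempty_proxHom_homeomorph⟩
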